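/- Let $n\ge 1$ and let $W$ be a $2n$-dimensional complex vector space with a non-degenerate skew-symmetric form $(\cdot,\cdot)$ and a basis $w_1,\dots,w_{2n}$ such that $(w_i,w_{2n+1-i})=1$ for $i=1,\dots,n$. Put $V=W\otimes\mathbb C[t,t^{-1}]$, with the basis $v_{2nk+j}=w_j\otimes t^{-k-1}$ ($1\le j\le 2n$, $k\in\mathbb Z$). Let $F^{(0)}$ be the charge zero sector of the semi-infinite wedge space: it has as a basis the monomials $v_{i_0}\wedge v_{i_1}\wedge\cdots$ with $i_0>i_1>\cdots$ and $i_k=-k$ for all large $k$. Let $|0\rangle=v_0\wedge v_{-1}\wedge v_{-2}\wedge\cdots$. The Sato Grassmannian $SGr_0\subset\mathbb P(F^{(0)})$ (Plücker embedding) consists of the subspaces $U\subset V$ for which there is $N\in\mathbb Z$ with $\mathrm{span}(v_N,v_{N-1},\dots)\subset U$ and $\dim U/\mathrm{span}(v_N,v_{N-1},\dots)=-N$. Let $\mathfrak{sp}_{2n}^a$ be the abelian Lie algebra with underlying vector space $\mathfrak{sp}_{2n}=\mathfrak{sp}(W)$. Let $\mathfrak{sp}^a_{2n}\otimes t^{-1}\mathbb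 C[t^{-1}]$ act on $V$ by $$(x\otimes t^i)(w\otimes t^j)=\begin{cases} xw\otimes t^{i+j}, & j\ge 0,\ i+j<0,\\ 0,&\text{otherwise,}\end{cases}$$ and on $F^{(0)}$ by the induced derivations. Let $\tilde L_0=U(\mathfrak{sp}^a_{2n}\otimes t^{-1}\mathbb C[t^{-1}])|0\rangle\subset F^{(0)}$, and let $G^a(\widehat{\mathfrak{sp}}_{2n})\subset\mathbb P(\tilde L_0)$ be the Zariski closure of the orbit of the group $\exp(\mathfrak{sp}^a_{2n}\otimes t^{-1}\mathbb C[t^{-1}])$ through the line $\mathbb C|0\rangle$. Here $\mathbb P(\tilde L_0)$ is regarded as the ind-variety that is the union of the $\mathbb P(E)$ over the finite-dimensional subspaces $E\subset\tilde L_0$: a subset is closed if and only if its intersection with every $\mathbb P(E)$ is Zariski closed. Then $G^a(\widehat{\mathfrak{sp}}_{2n})$, viewed in $\mathbb P(F^{(0)})$, consists exactly of those points $U$ of $SGr_0$ such that $U$ is isotropic for the form $\langle v\otimes t^i,w\otimes t^j\rangle=(v,w)\,\delta_{i+j,-1}$ and $\mathrm{pr}(tU)\subset U$, where $\mathrm{pr}:V\to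 V$ is the projection along $W\otimes 1$ to the span of the $W\otimes t^j$, $j\ne 0$. -/

import Mathlib

open scoped LinearAlgebra.Projectivization

noncomputable section

namespace SemiInf

/-! ### The charge zero sector of the semi-infinite wedge space -/

/-- Indices of the basis monomials `v_{i 0} ∧ v_{i 1} ∧ v_{i 2} ∧ …` of charge `0`: strictly
decreasing sequences of integers with `i k = -k` for all large `k`. -/
def Maya : Type := {i : ℕ → ℤ // StrictAnti i ∧ ∃ N : ℕ, ∀ k, N ≤ k → i k = -(k : ℤ)}

/-- The charge zero sector `F^(0)`: the vector space with the charge zero monomials as basis. -/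
abbrev Fock : Type := Maya →₀ ℂ

/-- The index of the vacuum, `0 > -1 > -2 > …`. -/
def vacIdx : Maya :=
  ⟨fun k => -(k : ℤ), fun a b h => by simpa using h, 0, fun _ _ => rfl⟩

/-- The vacuum vector `|0⟩ = v_0 ∧ v_{-1} ∧ v_{-2} ∧ …`. -/
def vac : Fock := Finsupp.single vacIdx 1

section

variable {V : Type*} [AddCommGroup V] [Module ℂ V] (v : Module.Basis ℤ ℂ V)

open Classical in
/-- The coordinate of `u_0 ∧ … ∧ u_{N-1} ∧ v_{-N} ∧ v_{-N-1} ∧ …` at the monomial `S`: an `N × N`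
minor if `S` agrees with the vacuum from position `N` on, and `0` otherwise. -/
def wedgeCoord (N : ℕ) (u : Fin N → V) (S : Maya) : ℂ :=
  if ∀ k, N ≤ k → S.1 k = -(k : ℤ) then
    (Matrix.of fun a b : Fin N => v.repr (u b) (S.1 a)).det
  else 0

theorem wedgeCoord_finite (N : ℕ) (u : Fin N → V) :
    (Function.support (wedgeCoord v N u)).Finite := by
  classical
  set T : Finset ℤ := Finset.univ.biUnion fun b : Fin N => (v.repr (u b)).support with hT
  refine Set.Finite.of_finite_image (f := fun (S : Maya) (a : Fin N) => S.1 a)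
    (Set.Finite.subset (Set.Finite.pi' (fun _ : Fin N => T.finite_toSet)) ?_) ?_
  · rintro _ ⟨S, hS, rfl⟩ a
    by_contra hcon
    refine hS ?_
    unfold wedgeCoord
    split_ifs
    · refine Matrix.det_eq_zero_of_row_eq_zero a fun b => ?_
      by_contra hb
      refine hcon ?_
      simp only [hT, Finset.coe_biUnion, Set.mem_iUnion]
      exact ⟨b, by simp, by simpa using hb⟩
    · rfl
  · intro S hS S' hS' h
    have key : ∀ R : Maya, R ∈ Function.support (wedgeCoord v N u) →
        ∀ k, N ≤ k → R.1 k = -(k : ℤ) := by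
      intro R hR
      by_contra hcon
      exact hR (by simp only [wedgeCoord, if_neg hcon])
    refine Subtype.ext (funext fun k => ?_)
    rcases lt_or_ge k N with hk | hk
    · exact congrFun h ⟨k, hk⟩
    · rw [key S hS k hk, key S' hS' k hk]

/-- The vector `u_0 ∧ … ∧ u_{N-1} ∧ v_{-N} ∧ v_{-N-1} ∧ …` of `F^(0)`. -/
def wedge (N : ℕ) (u : Fin N → V) : Fock :=
  Finsupp.ofSupportFinite (wedgeCoord v N u) (wedgeCoord_finite v N u)

open Classical in
/-- The vector `u_0 ∧ u_1 ∧ u_2 ∧ …` of `F^(0)`, for a sequence `u` in `V` such that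
`u_k = v_{-k}` for all large `k` (and `0` for any other sequence). -/
def wedgeSeq (u : ℕ → V) : Fock :=
  if h : ∃ N : ℕ, ∀ k, N ≤ k → u k = v (-(k : ℤ)) then
    wedge v h.choose fun a => u a
  else 0

/-- The action on `F^(0)` of an operator `A` on `V` that annihilates all but finitely many of the
basis vectors: the derivation
`A (v_{i 0} ∧ v_{i 1} ∧ …) = ∑ k, v_{i 0} ∧ … ∧ A v_{i k} ∧ …`. -/
def derivAct (A : V →ₗ[ℂ] V) : Module.End ℂ Fock :=
  Finsupp.linearCombination ℂ fun S : Maya =>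
    ∑ᶠ k : ℕ, wedgeSeq v (Function.update (fun l => v (S.1 l)) k (A (v (S.1 k))))

/-- The span of `v_N, v_{N-1}, v_{N-2}, …`. -/
def lower (N : ℤ) : Submodule ℂ V := Submodule.span ℂ (v '' Set.Iic N)

/-- The points of the Sato Grassmannian `SGr_m`, as subspaces of `V`. -/
def sato (m : ℤ) : Set (Submodule ℂ V) :=
  {U | ∃ N : ℤ, lower v N ≤ U ∧
    Module.Finite ℂ (U ⧸ (lower v N).comap U.subtype) ∧
    (Module.finrank ℂ (U ⧸ (lower v N).comap U.subtype) : ℤ) = m - N}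

/-- The Plücker line in `F^(0)` of a point `U` of `SGr_0`: it is spanned by `u_0 ∧ u_1 ∧ …`, where
`u_0, u_1, …` spans `U` and `u_k = v_{-k}` for all large `k`. -/
def pluckerLine (U : Submodule ℂ V) : Submodule ℂ Fock :=
  Submodule.span ℂ {φ | ∃ u : ℕ → V, (∃ N : ℕ, ∀ k, N ≤ k → u k = v (-(k : ℤ))) ∧
    Submodule.span ℂ (Set.range u) = U ∧ φ = wedgeSeq v u}

end

/-! ### The Zariski topology of an infinite dimensional projective space -/

/-- `Z ⊆ ℙ(L)` is closed if for every finite dimensional subspace `E ⊆ L` its intersection with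
`ℙ(E)` is the zero set in `ℙ(E)` of some homogeneous polynomials in the linear forms. -/
def IsIndClosed {L : Type*} [AddCommGroup L] [Module ℂ L] (Z : Set (ℙ ℂ L)) : Prop :=
  ∀ E : Submodule ℂ L, Module.Finite ℂ E →
    ∃ P : Set (MvPolynomial (Module.Dual ℂ L) ℂ),
      (∀ f ∈ P, ∃ d : ℕ, f.IsHomogeneous d) ∧
      ∀ p : ℙ ℂ L, p.submodule ≤ E →
        (p ∈ Z ↔ ∀ f ∈ P, MvPolynomial.eval (fun l : Module.Dual ℂ L => l p.rep) f = 0)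

/-- The Zariski topology of `ℙ(L)` as the ind-variety `⋃ ℙ(E)`, the union being over the finite
dimensional subspaces `E ⊆ L`. -/
@[reducible]
def indZariski (L : Type*) [AddCommGroup L] [Module ℂ L] : TopologicalSpace (ℙ ℂ L) :=
  TopologicalSpace.ofClosed {Z | IsIndClosed Z}
    (by
      intro E _
      refine ⟨{1}, ?_, ?_⟩
      · rintro f rfl
        exact ⟨0, MvPolynomial.isHomogeneous_one _ _⟩
      · intro p _
        simp)
    (by
      intro A hA E hE
      choose! P hP using fun Z (hZ : Z ∈ A) => hA hZ E hE
      refine ⟨⋃ Z ∈ A, P Z, ?_, ?_⟩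
      · intro f hf
        simp only [Set.mem_iUnion] at hf
        obtain ⟨Z, hZ, hf⟩ := hf
        exact (hP Z hZ).1 f hf
      · intro p hp
        simp only [Set.mem_sInter, Set.mem_iUnion]
        constructor
        · rintro h f ⟨Z, hZ, hf⟩
          exact ((hP Z hZ).2 p hp).1 (h Z hZ) f hf
        · intro h Z hZ
          exact ((hP Z hZ).2 p hp).2 fun f hf => h f ⟨Z, hZ, hf⟩)
    (by
      intro Z₁ h₁ Z₂ h₂ E hE
      obtain ⟨P₁, hP₁, hZ₁⟩ := h₁ E hE
      obtain ⟨P₂, hP₂, hZ₂⟩ := h₂ E hE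
      refine ⟨Set.image2 (fun f g => f * g) P₁ P₂, ?_, ?_⟩
      · rintro _ ⟨f, hf, g, hg, rfl⟩
        obtain ⟨d, hd⟩ := hP₁ f hf
        obtain ⟨e, he⟩ := hP₂ g hg
        exact ⟨d + e, hd.mul he⟩
      · intro p hp
        rw [Set.mem_union, hZ₁ p hp, hZ₂ p hp]
        constructor
        · rintro (h | h) _ ⟨f, hf, g, hg, rfl⟩
          · simp [h f hf]
          · simp [h g hg]
        · intro h
          by_contra hcon
          push Not at hcon
          obtain ⟨⟨f, hf, hf0⟩, g, hg, hg0⟩ := hcon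
          have := h _ ⟨f, hf, g, hg, rfl⟩
          rw [map_mul] at this
          exact (mul_ne_zero hf0 hg0) this)

/-! ### The loop space `W ⊗ ℂ[t, t⁻¹]`

It is modelled as `ℤ →₀ W`, with `w ⊗ t^j` being `Finsupp.single j w`. -/

section

variable {W : Type*} [AddCommGroup W] [Module ℂ W]

/-- The reindexing `d * k + j ↔ w_j ⊗ t^(-k-1)`, where `j = 1, …, d` (so `w_j` has the zero-based
index `j - 1`). -/
def foldEquiv (d : ℕ) [NeZero d] : (Σ _ : ℤ, Fin d) ≃ ℤ where
  toFun e := (d : ℤ) * (-e.1 - 1) + (e.2 : ℤ) + 1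
  invFun m := ⟨-(Int.divModEquiv d (m - 1)).1 - 1, (Int.divModEquiv d (m - 1)).2⟩
  left_inv e := by
    obtain ⟨i, j⟩ := e
    have h : (d : ℤ) * (-i - 1) + (j : ℤ) + 1 - 1 = (Int.divModEquiv d).symm (-i - 1, j) := by
      simp only [Int.divModEquiv_symm_apply]; ring
    simp only [h, Equiv.apply_symm_apply]
    congr 1
    ring
  right_inv m := by
    have h := (Int.divModEquiv d).symm_apply_apply (m - 1)
    rw [Int.divModEquiv_symm_apply] at h
    linear_combination h

/-- The basis `v_{d * k + j} = w_j ⊗ t^(-k-1)`, `j = 1, …, d`, `k ∈ ℤ`, of `W ⊗ ℂ[t, t⁻¹]`. -/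
def loopBasis {d : ℕ} [NeZero d] (w : Module.Basis (Fin d) ℂ W) : Module.Basis ℤ ℂ (ℤ →₀ W) :=
  (Finsupp.basis fun _ : ℤ => w).reindex (foldEquiv d)

theorem loopBasis_apply {d : ℕ} [NeZero d] (w : Module.Basis (Fin d) ℂ W) (k : ℤ) (j : Fin d) :
    loopBasis w (d * k + (j : ℤ) + 1) = Finsupp.single (-k - 1) (w j) := by
  have h : (d : ℤ) * k + (j : ℤ) + 1 = foldEquiv d ⟨-k - 1, j⟩ := by
    simp only [foldEquiv, Equiv.coe_fn_mk]; ring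
  rw [loopBasis, Module.Basis.reindex_apply, h, Equiv.symm_apply_apply, Finsupp.coe_basis]

/-- Multiplication by `t`. -/
def mulT : (ℤ →₀ W) →ₗ[ℂ] (ℤ →₀ W) := Finsupp.lmapDomain W ℂ fun j : ℤ => j + 1

/-- The projection along `W ⊗ 1` to the span of the `W ⊗ t^j`, `j ≠ 0`. -/
def pr : (ℤ →₀ W) →ₗ[ℂ] (ℤ →₀ W) :=
  LinearMap.id - Finsupp.lsingle (0 : ℤ) ∘ₗ Finsupp.lapply (0 : ℤ)

/-- The form `⟨a ⊗ t^i, b ⊗ t^j⟩ = (a, b) δ_{i+j,-1}` on `W ⊗ ℂ[t, t⁻¹]`. -/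
def loopForm (B : LinearMap.BilinForm ℂ W) (x y : ℤ →₀ W) : ℂ :=
  x.sum fun i a => y.sum fun j b => if i + j = -1 then B a b else 0

/-- The degenerate action of `x ⊗ t^i` on `W ⊗ ℂ[t, t⁻¹]`: it maps `w ⊗ t^j` to `x w ⊗ t^(i+j)` if
`j ≥ 0` and `i + j < 0`, and to `0` otherwise. -/
def degAct (x : Module.End ℂ W) (i : ℤ) : (ℤ →₀ W) →ₗ[ℂ] (ℤ →₀ W) :=
  Finsupp.lsum ℂ fun j : ℤ =>
    if 0 ≤ j ∧ i + j < 0 then Finsupp.lsingle (i + j) ∘ₗ x else 0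

/-- The underlying vector space of the symplectic Lie algebra of the form `B`: all `x` with
`(x a, b) = -(a, x b)`. -/
abbrev sp (B : LinearMap.BilinForm ℂ W) : Submodule ℂ (Module.End ℂ W) :=
  LinearMap.skewAdjointSubmodule B

/-- The underlying vector space of the abelian Lie algebra `sp^a ⊗ t⁻¹ ℂ[t⁻¹]`: the function `X`
stands for `∑ k, X k ⊗ t^(-(k+1))`, `k = 0, 1, 2, …`. -/
abbrev SpLoop (B : LinearMap.BilinForm ℂ W) : Type _ := ℕ →₀ sp B

/-- The action of `sp^a ⊗ t⁻¹ ℂ[t⁻¹]` on `W ⊗ ℂ[t, t⁻¹]`. -/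
def loopAct (B : LinearMap.BilinForm ℂ W) (X : SpLoop B) : (ℤ →₀ W) →ₗ[ℂ] (ℤ →₀ W) :=
  X.sum fun k x => degAct (x : Module.End ℂ W) (-((k : ℤ) + 1))

variable {d : ℕ} [NeZero d] (B : LinearMap.BilinForm ℂ W) (w : Module.Basis (Fin d) ℂ W)

/-- The action of `sp^a ⊗ t⁻¹ ℂ[t⁻¹]` on `F^(0)`. -/
def fockAct (X : SpLoop B) : Module.End ℂ Fock := derivAct (loopBasis w) (loopAct B X)

/-- The space generated from the vacuum by the action of the enveloping algebra of
`sp^a ⊗ t⁻¹ ℂ[t⁻¹]`. -/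
def vacModule : Submodule ℂ Fock :=
  (Subalgebra.toSubmodule (Algebra.adjoin ℂ (Set.range (fockAct B w)))).map
    (LinearMap.applyₗ vac)

/-- The orbit of the group `exp (sp^a ⊗ t⁻¹ ℂ[t⁻¹])` through the vacuum line in the projective
space of `vacModule`. The operators `fockAct B w X` are nilpotent. -/
def orbit : Set (ℙ ℂ (vacModule B w)) :=
  {p | ∃ X : SpLoop B, p.submodule.map (vacModule B w).subtype =
    Submodule.span ℂ {IsNilpotent.exp (fockAct B w X) vac}}

/-- The closure of the orbit, as a set of points of `ℙ(F^(0))`. -/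
def orbitClosure : Set (ℙ ℂ Fock) :=
  Projectivization.map (vacModule B w).subtype (vacModule B w).injective_subtype ''
    @closure _ (indZariski (vacModule B w)) (orbit B w)

end

end SemiInf

end

/-! A point `U` of `SGr_0` is handled through a finite frame `u_0, …, u_{N-1}` modulo `lower (-N)`,
and its Plücker vector through the corresponding minors. Write `τ = pr t` (`tau`). It is
self-adjoint for the form, and an isotropic point of `SGr_0` is Lagrangian
(`mem_of_forall_lform_eq_zero`). Call `U` admissible if it is isotropic and `τ`-stable.

Orbit: an element `X` of the abelian algebra acts on `V` with square zero, so its exponential on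
Fock space is the operator induced by `1 + X` (`derivAct_isNilpotent_and_exp`). The orbit therefore
consists of the subspaces `(1 + X) W[t]`, which are admissible. Conversely, an admissible `U` that
meets `t⁻¹W[t⁻¹]` only in `0` is such a graph (`exists_eq_map_loopAct`): `τ`-stability determines
`U` from its part over `W ⊗ 1`, and isotropy puts the coefficients in `sp`.

Closure is admissible: for a Lagrangian `U`, `τ`-stability says that `⟨τ x, y⟩` vanishes on `U`.
Both conditions are thus the vanishing of bilinear forms, which is closed in the ind-Zariski
topology (`isIndClosed_isotropic`).

Admissible lies in the closure: induction on `dim (U ∩ W ⊗ t⁻¹)`. If `U` meets `t⁻¹W[t⁻¹]`, then it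
contains some `p ≠ 0` in `W ⊗ t⁻¹`. Let `m` be maximal with `p ∈ τ^m U`, and let `f` be orthogonal
to `τ^(m+1) U` but not to `p`. The operator `y x = ∑_{i+j=m} ⟨f, τ^i x⟩ τ^j f` is skew with `y² =
0`, and commutes with `τ` up to two boundary terms that are harmless on `U`. For `s ≠ 0` the
subspace `(1 + s y) U` is admissible with a smaller intersection with `W ⊗ t⁻¹` (`exists_shear`),
and it tends to `U` as `s → 0` (`exists_mem_of_shear`). -/

noncomputable section

namespace SemiInf

/-! ### Finite frames and their semi-infinite wedge products. -/

section Wedge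

variable {V : Type*} [AddCommGroup V] [Module ℂ V] (v : Module.Basis ℤ ℂ V)

/-- The monomial `S` agrees with the vacuum from position `N` on. -/
def IsTail (N : ℕ) (S : Maya) : Prop := ∀ k, N ≤ k → S.1 k = -(k : ℤ)

theorem IsTail.mono {N M : ℕ} (h : N ≤ M) {S : Maya} (hS : IsTail N S) : IsTail M S :=
  fun k hk => hS k (h.trans hk)

theorem IsTail.lt {N : ℕ} {S : Maya} (hS : IsTail N S) (a : Fin N) : -(N : ℤ) < S.1 a := by
  have := S.2.1 a.2
  rwa [hS N le_rfl] at this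

theorem exists_isTail (S : Maya) : ∃ N, IsTail N S := S.2.2

theorem mem_lower_iff {N : ℤ} {x : V} : x ∈ lower v N ↔ ∀ j, N < j → v.repr x j = 0 := by
  rw [lower, Module.Basis.mem_span_image]
  constructor
  · intro h j hj
    by_contra hx
    have := h (Finsupp.mem_support_iff.2 hx)
    simp only [Set.mem_Iic] at this
    omega
  · intro h j hj
    by_contra hx
    exact Finsupp.mem_support_iff.1 hj (h j (by simpa using hx))

theorem basis_mem_lower {N j : ℤ} (h : j ≤ N) : v j ∈ lower v N :=
  Submodule.subset_span ⟨j, h, rfl⟩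

theorem lower_mono {N M : ℤ} (h : N ≤ M) : lower v N ≤ lower v M :=
  Submodule.span_mono (Set.image_mono (Set.Iic_subset_Iic.2 h))

theorem exists_mem_lower (x : V) : ∃ N : ℕ, x ∈ lower v N := by
  obtain ⟨N, hN⟩ := (v.repr x).support.bddAbove
  refine ⟨N.toNat, (mem_lower_iff v).2 fun j hj => ?_⟩
  by_contra hx
  have := hN (Finsupp.mem_support_iff.2 hx)
  omega

theorem exists_mem_lower_fin {N : ℕ} (u : Fin N → V) : ∃ M : ℕ, ∀ a, u a ∈ lower v M := by
  choose M hM using fun a => exists_mem_lower v (u a)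
  exact ⟨Finset.univ.sup M, fun a =>
    lower_mono v (by exact_mod_cast Finset.le_sup (Finset.mem_univ a)) (hM a)⟩

/-- The `N × N` matrix of coordinates of `u` in the rows `J`. -/
def rowMat {N : ℕ} (u : Fin N → V) (J : Fin N → ℤ) : Matrix (Fin N) (Fin N) ℂ :=
  Matrix.of fun a b => v.repr (u b) (J a)

theorem wedge_apply_of_isTail {N : ℕ} (u : Fin N → V) {S : Maya} (hS : IsTail N S) :
    wedge v N u S = (rowMat v u fun a => S.1 a).det := by
  change wedgeCoord v N u S = _
  exact if_pos hS

theorem wedge_apply_of_not_isTail {N : ℕ} (u : Fin N → V) {S : Maya} (hS : ¬ IsTail N S) :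
    wedge v N u S = 0 := by
  change wedgeCoord v N u S = _
  exact if_neg hS

/-- The minor with rows `J`, as an alternating map. -/
def minorAlt {N : ℕ} (J : Fin N → ℤ) : V [⋀^Fin N]→ₗ[ℂ] ℂ :=
  (Matrix.detRowAlternating (n := Fin N) (R := ℂ)).compLinearMap
    (LinearMap.pi fun a => (Finsupp.lapply (J a)).comp v.repr.toLinearMap)

theorem minorAlt_apply {N : ℕ} (J : Fin N → ℤ) (u : Fin N → V) :
    minorAlt v J u = (rowMat v u J).det := by
  rw [← Matrix.det_transpose]
  rfl

/-- `u ↦ u_0 ∧ … ∧ u_{N-1} ∧ v_{-N} ∧ v_{-N-1} ∧ …` as an alternating map. -/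
def wedgeAlt (N : ℕ) : V [⋀^Fin N]→ₗ[ℂ] Fock where
  toFun := wedge v N
  map_update_add' {inst} u i x y := by
    cases Subsingleton.elim inst (instDecidableEqFin N)
    ext S
    by_cases hS : IsTail N S
    · simp only [Finsupp.add_apply, wedge_apply_of_isTail v _ hS, ← minorAlt_apply]
      exact (minorAlt v _).map_update_add u i x y
    · simp only [Finsupp.add_apply, wedge_apply_of_not_isTail v _ hS, add_zero]
  map_update_smul' {inst} u i c x := by
    cases Subsingleton.elim inst (instDecidableEqFin N)
    ext S
    by_cases hS : IsTail N S
    · simp only [Finsupp.smul_apply, wedge_apply_of_isTail v _ hS, ← minorAlt_apply]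
      exact (minorAlt v _).map_update_smul u i c x
    · simp only [Finsupp.smul_apply, wedge_apply_of_not_isTail v _ hS, smul_zero]
  map_eq_zero_of_eq' u i j h hij := by
    ext S
    by_cases hS : IsTail N S
    · rw [wedge_apply_of_isTail v _ hS, ← minorAlt_apply]
      exact (minorAlt v _).map_eq_zero_of_eq u h hij
    · rw [wedge_apply_of_not_isTail v _ hS]; rfl

@[simp] theorem wedgeAlt_apply (N : ℕ) (u : Fin N → V) : wedgeAlt v N u = wedge v N u := rfl

/-- A vector whose coordinates in the basis combine as prescribed by a matrix has the
corresponding minors. -/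
theorem rowMat_comb {N : ℕ} {u u' : Fin N → V} {G : Matrix (Fin N) (Fin N) ℂ} {J : Fin N → ℤ}
    {m : ℤ} (h : ∀ b, u' b - ∑ c, G c b • u c ∈ lower v m) (hJ : ∀ a, m < J a) :
    rowMat v u' J = rowMat v u J * G := by
  ext a b
  have := (mem_lower_iff v).1 (h b) (J a) (hJ a)
  simp only [map_sub, map_sum, map_smul, Finsupp.sub_apply, Finsupp.finsetSum_apply,
    Finsupp.smul_apply, smul_eq_mul, sub_eq_zero] at this
  simp only [rowMat, Matrix.of_apply, this, Matrix.mul_apply, mul_comm]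

/-- The minors only involve rows above `-N`, so errors in `lower (-N)` are invisible and a change of
frame multiplies every minor by `G.det`. -/
theorem wedge_comb {N : ℕ} {u u' : Fin N → V} {G : Matrix (Fin N) (Fin N) ℂ}
    (h : ∀ b, u' b - ∑ c, G c b • u c ∈ lower v (-(N : ℤ))) :
    wedge v N u' = G.det • wedge v N u := by
  ext S
  by_cases hS : IsTail N S
  · rw [Finsupp.smul_apply, wedge_apply_of_isTail v _ hS, wedge_apply_of_isTail v _ hS,
      rowMat_comb v h hS.lt, Matrix.det_mul, smul_eq_mul, mul_comm]
  · rw [Finsupp.smul_apply, wedge_apply_of_not_isTail v _ hS, wedge_apply_of_not_isTail v _ hS,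
      smul_zero]

theorem wedge_eq_zero_of_mem_lower {N : ℕ} {u : Fin N → V} (a : Fin N)
    (h : u a ∈ lower v (-(N : ℤ))) : wedge v N u = 0 := by
  ext S
  by_cases hS : IsTail N S
  · rw [wedge_apply_of_isTail v _ hS]
    exact Matrix.det_eq_zero_of_column_eq_zero a fun b => (mem_lower_iff v).1 h _ (hS.lt b)
  · rw [wedge_apply_of_not_isTail v _ hS]; rfl

theorem Maya.eq_of_range_eq {S T : Maya} (h : Set.range S.1 = Set.range T.1) : S = T := by
  have h1 : StrictMono (fun k => OrderDual.toDual (S.1 k)) := S.2.1.dual_right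
  have h2 : StrictMono (fun k => OrderDual.toDual (T.1 k)) := T.2.1.dual_right
  refine Subtype.ext ((h1.range_inj h2).1 ?_)
  exact h

theorem IsTail.mem_range_iff {N : ℕ} {S T : Maya} (hS : IsTail N S) (hT : IsTail N T) :
    Set.range S.1 ⊆ Set.range T.1 ↔ ∀ a : Fin N, ∃ b : Fin N, S.1 a = T.1 b := by
  constructor
  · intro h a
    obtain ⟨k, hk⟩ := h ⟨a, rfl⟩
    refine ⟨⟨k, ?_⟩, hk.symm⟩
    by_contra hkN
    have h1 := hT k (not_lt.1 hkN)
    have h2 := hS.lt a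
    omega
  · rintro h _ ⟨k, rfl⟩
    rcases lt_or_ge k N with hk | hk
    · obtain ⟨b, hb⟩ := h ⟨k, hk⟩
      exact ⟨b, hb.symm⟩
    · exact ⟨k, by rw [hS k hk, hT k hk]⟩

theorem wedge_maya {N : ℕ} {S : Maya} (hS : IsTail N S) :
    wedge v N (fun a => v (S.1 a)) = Finsupp.single S 1 := by
  classical
  ext T
  by_cases hT : IsTail N T
  swap
  · rw [wedge_apply_of_not_isTail v _ hT, Finsupp.single_eq_of_ne]
    rintro rfl
    exact hT hS
  rw [wedge_apply_of_isTail v _ hT]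
  by_cases hST : S = T
  · subst hST
    have : rowMat v (fun a : Fin N => v (S.1 a)) (fun a => S.1 a) = 1 := by
      ext a b
      simp only [rowMat, Matrix.of_apply, Module.Basis.repr_self, Matrix.one_apply,
        Finsupp.single_apply, S.2.1.injective.eq_iff, Fin.val_inj, eq_comm]
    rw [this, Matrix.det_one, Finsupp.single_eq_same]
  · rw [Finsupp.single_eq_of_ne (Ne.symm hST)]
    by_contra hdet
    refine hST (Maya.eq_of_range_eq (Set.Subset.antisymm ((hS.mem_range_iff hT).2 ?_)
      ((hT.mem_range_iff hS).2 ?_)))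
    · intro a
      by_contra hcon
      push Not at hcon
      exact hdet (Matrix.det_eq_zero_of_column_eq_zero a fun b => by
        simp [rowMat, hcon b])
    · intro a
      by_contra hcon
      push Not at hcon
      exact hdet (Matrix.det_eq_zero_of_row_eq_zero a fun b => by
        simp [rowMat, Ne.symm (hcon b)])

theorem exists_sort {N : ℕ} {J : Fin N → ℤ} (hinj : Function.Injective J)
    (hJ : ∀ a, -(N : ℤ) < J a) :
    ∃ S : Maya, IsTail N S ∧ ∃ σ : Equiv.Perm (Fin N), ∀ a, J a = S.1 (σ a) := by
  set f : Fin N → ℤ := fun a => -J a with hf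
  have hm : StrictMono (f ∘ Tuple.sort f) :=
    (Tuple.monotone_sort f).strictMono_of_injective
      ((neg_injective.comp hinj).comp (Tuple.sort f).injective)
  set s : ℕ → ℤ := fun k => if h : k < N then J (Tuple.sort f ⟨k, h⟩) else -(k : ℤ) with hs
  have hsa : StrictAnti s := by
    intro a b hab
    simp only [hs]
    by_cases hb : b < N
    · have := hm (show (⟨a, hab.trans hb⟩ : Fin N) < ⟨b, hb⟩ from hab)
      rw [dif_pos hb, dif_pos (hab.trans hb)]
      exact neg_lt_neg_iff.1 this
    · rw [dif_neg hb]
      split_ifs with ha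
      · have := hJ (Tuple.sort f ⟨a, ha⟩)
        omega
      · omega
  refine ⟨⟨s, hsa, N, fun k hk => dif_neg (not_lt.2 hk)⟩, fun k hk => dif_neg (not_lt.2 hk),
    (Tuple.sort f).symm, fun a => ?_⟩
  simp [hs]

/-- Alternating maps that vanish on `lower (-N)` are determined by their values on monomials. -/
theorem alternating_ext {N : ℕ} {E : Type*} [AddCommGroup E] [Module ℂ E]
    {f g : V [⋀^Fin N]→ₗ[ℂ] E}
    (h0 : ∀ (u : Fin N → V) a j, j ≤ -(N : ℤ) → u a = v j → f u = 0 ∧ g u = 0)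
    (h : ∀ S : Maya, IsTail N S → f (fun a => v (S.1 a)) = g fun a => v (S.1 a)) : f = g := by
  refine v.ext_alternating fun J hJ => ?_
  by_cases hlow : ∀ a, -(N : ℤ) < J a
  · obtain ⟨S, hS, σ, hσ⟩ := exists_sort hJ hlow
    have : (fun i => v (J i)) = (fun a : Fin N => v (S.1 a)) ∘ σ := by
      funext a; simp [hσ]
    rw [this, AlternatingMap.map_perm, AlternatingMap.map_perm, h S hS]
  · push Not at hlow
    obtain ⟨a, ha⟩ := hlow
    obtain ⟨h1, h2⟩ := h0 (fun i => v (J i)) a (J a) ha rfl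
    rw [h1, h2]

/-- The last column of the larger minor is the coordinate vector of `v_{-N}`. Either `-N` is the
last row index and Laplace expansion leaves the smaller minor, or `-N` is not an index of `S` and
the column is zero. -/
theorem wedge_succ {N : ℕ} (u : ℕ → V) (h : u N = v (-(N : ℤ))) :
    wedge v (N + 1) (fun a => u a) = wedge v N fun a => u a := by
  ext S
  have hcol : ∀ j : ℤ, j ≠ -(N : ℤ) → v.repr (u N) j = 0 := by
    intro j hj
    rw [h, Module.Basis.repr_self, Finsupp.single_eq_of_ne hj]
  by_cases hS1 : IsTail (N + 1) S
  swap
  · rw [wedge_apply_of_not_isTail v _ hS1,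
      wedge_apply_of_not_isTail v _ fun hS => hS1 (hS.mono N.le_succ)]
  rw [wedge_apply_of_isTail v _ hS1]
  by_cases hS : IsTail N S
  · rw [wedge_apply_of_isTail v _ hS, Matrix.det_succ_column _ (Fin.last N)]
    rw [Finset.sum_eq_single (Fin.last N)]
    · have h1 : v.repr (u N) (S.1 N) = 1 := by
        rw [h, hS N le_rfl]; simp
      simp only [rowMat, Fin.val_last, Matrix.of_apply, h1, Fin.succAbove_last, mul_one]
      rw [← two_mul, pow_mul]
      simp only [even_two, Even.neg_pow, one_pow, one_mul]
      rfl
    · intro a _ ha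
      have : v.repr (u N) (S.1 a) = 0 := by
        apply hcol
        rw [← hS N le_rfl]
        exact fun hh => ha (Fin.ext (S.2.1.injective hh))
      simp [rowMat, this]
    · simp
  · rw [wedge_apply_of_not_isTail v _ hS]
    -- If `-N` occurred among the first `N + 1` indices, monotonicity would force `S N = -N`, and
    -- `S` would be a tail from `N` on.
    refine Matrix.det_eq_zero_of_column_eq_zero (Fin.last N) fun a => hcol _ fun hh => ?_
    have h2 : S.1 N ≤ S.1 a := S.2.1.antitone (Nat.lt_succ_iff.1 a.2)
    have h3 : S.1 (N + 1) < S.1 N := S.2.1 N.lt_succ_self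
    rw [hS1 (N + 1) le_rfl] at h3
    push_cast at h3
    replace hh : S.1 a = -(N : ℤ) := hh
    refine hS fun k hk => ?_
    rcases hk.eq_or_lt with rfl | hk
    · omega
    · exact hS1 k hk

theorem wedge_eq_of_le {N M : ℕ} (hNM : N ≤ M) (u : ℕ → V)
    (h : ∀ k, N ≤ k → u k = v (-(k : ℤ))) :
    wedge v M (fun a => u a) = wedge v N fun a => u a := by
  induction M, hNM using Nat.le_induction with
  | base => rfl
  | succ M hM ih => rw [wedge_succ v u (h M hM), ih]

theorem wedgeSeq_eq {N : ℕ} {u : ℕ → V} (h : ∀ k, N ≤ k → u k = v (-(k : ℤ))) :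
    wedgeSeq v u = wedge v N fun a => u a := by
  have hex : ∃ N : ℕ, ∀ k, N ≤ k → u k = v (-(k : ℤ)) := ⟨N, h⟩
  rw [wedgeSeq, dif_pos hex]
  rw [← wedge_eq_of_le v (le_max_left hex.choose N) u hex.choose_spec,
    ← wedge_eq_of_le v (le_max_right hex.choose N) u h]

/-- The sequence `u_0, …, u_{N-1}, v_{-N}, v_{-N-1}, …`. -/
def extend {N : ℕ} (u : Fin N → V) (k : ℕ) : V := if h : k < N then u ⟨k, h⟩ else v (-(k : ℤ))

theorem extend_of_ge {N : ℕ} (u : Fin N → V) {k : ℕ} (h : N ≤ k) : extend v u k = v (-(k : ℤ)) :=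
  dif_neg (not_lt.2 h)

@[simp] theorem extend_fin {N : ℕ} (u : Fin N → V) (a : Fin N) : extend v u a = u a :=
  dif_pos a.2

theorem wedge_extend {N M : ℕ} (hNM : N ≤ M) (u : Fin N → V) :
    wedge v M (fun a => extend v u a) = wedge v N u := by
  rw [wedge_eq_of_le v hNM _ fun k hk => extend_of_ge v u hk]
  simp

/-- The subspace spanned by `u_0, …, u_{N-1}, v_{-N}, v_{-N-1}, …`. -/
def frameSpan (N : ℕ) (u : Fin N → V) : Submodule ℂ V :=
  Submodule.span ℂ (Set.range u) ⊔ lower v (-(N : ℤ))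

theorem mem_frameSpan {N : ℕ} (u : Fin N → V) (a : Fin N) : u a ∈ frameSpan v N u :=
  Submodule.mem_sup_left (Submodule.subset_span ⟨a, rfl⟩)

theorem lower_le_frameSpan {N : ℕ} (u : Fin N → V) : lower v (-(N : ℤ)) ≤ frameSpan v N u :=
  le_sup_right

theorem frameSpan_le {N : ℕ} {u : Fin N → V} {U : Submodule ℂ V} (h : ∀ a, u a ∈ U)
    (hl : lower v (-(N : ℤ)) ≤ U) : frameSpan v N u ≤ U :=
  sup_le (Submodule.span_le.2 (Set.range_subset_iff.2 h)) hl

theorem mem_frameSpan_iff {N : ℕ} {u : Fin N → V} {x : V} :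
    x ∈ frameSpan v N u ↔ ∃ c : Fin N → ℂ, x - ∑ b, c b • u b ∈ lower v (-(N : ℤ)) := by
  rw [frameSpan, Submodule.mem_sup]
  constructor
  · rintro ⟨y, hy, z, hz, rfl⟩
    obtain ⟨c, rfl⟩ := (Submodule.mem_span_range_iff_exists_fun ℂ).1 hy
    exact ⟨c, by simpa using hz⟩
  · rintro ⟨c, hc⟩
    exact ⟨_, (Submodule.mem_span_range_iff_exists_fun ℂ).2 ⟨c, rfl⟩, _, hc, by abel⟩

theorem span_range_eq {N : ℕ} {u : ℕ → V} (h : ∀ k, N ≤ k → u k = v (-(k : ℤ))) :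
    Submodule.span ℂ (Set.range u) = frameSpan v N fun a => u a := by
  apply le_antisymm
  · rw [Submodule.span_le]
    rintro _ ⟨k, rfl⟩
    rcases lt_or_ge k N with hk | hk
    · exact mem_frameSpan v (fun a : Fin N => u a) ⟨k, hk⟩
    · rw [h k hk]
      exact lower_le_frameSpan v _ (basis_mem_lower v (by omega))
  · refine frameSpan_le v (fun a => Submodule.subset_span ⟨a, rfl⟩) ?_
    rw [lower, Submodule.span_le]
    rintro _ ⟨j, hj, rfl⟩
    simp only [Set.mem_Iic] at hj
    refine Submodule.subset_span ⟨(-j).toNat, ?_⟩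
    rw [h _ (by omega)]
    congr 1
    omega

theorem frameSpan_extend {N M : ℕ} (hNM : N ≤ M) (u : Fin N → V) :
    frameSpan v M (fun a => extend v u a) = frameSpan v N u := by
  rw [← span_range_eq v fun k hk => extend_of_ge v u (hNM.trans hk),
    span_range_eq v fun k hk => extend_of_ge v u hk]
  simp

theorem frameSpan_comb {N : ℕ} {u u' : Fin N → V} {G : Matrix (Fin N) (Fin N) ℂ}
    (h : ∀ b, u' b - ∑ c, G c b • u c ∈ lower v (-(N : ℤ))) (hG : G.det ≠ 0) :
    frameSpan v N u' = frameSpan v N u := by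
  apply le_antisymm
  · exact frameSpan_le v (fun a => (mem_frameSpan_iff v).2 ⟨_, h a⟩) (lower_le_frameSpan v _)
  · refine frameSpan_le v (fun a => (mem_frameSpan_iff v).2 ⟨fun b => G⁻¹ b a, ?_⟩)
      (lower_le_frameSpan v _)
    have h1 : ∑ b, G⁻¹ b a • (∑ c, G c b • u c) = u a := by
      simp only [Finset.smul_sum, smul_smul]
      rw [Finset.sum_comm]
      have : ∀ c, ∑ b, (G⁻¹ b a * G c b) • u c = (G * G⁻¹) c a • u c := by
        intro c
        rw [← Finset.sum_smul, Matrix.mul_apply]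
        congr 1
        exact Finset.sum_congr rfl fun b _ => mul_comm _ _
      simp only [this, Matrix.mul_nonsing_inv G (isUnit_iff_ne_zero.2 hG), Matrix.one_apply,
        ite_smul, one_smul, zero_smul, Finset.sum_ite_eq', Finset.mem_univ, if_true]
    have h2 : u a - ∑ b, G⁻¹ b a • u' b =
        -∑ b, G⁻¹ b a • (u' b - ∑ c, G c b • u c) := by
      simp only [smul_sub, Finset.sum_sub_distrib, h1]
      abel
    rw [h2]
    exact neg_mem (sum_mem fun b _ => Submodule.smul_mem _ _ (h b))

end Wedge

/-! ### The Plücker embedding: frames of points of `SGr_0` and their recovery from the coordinates.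
-/

section Plucker

variable {V : Type*} [AddCommGroup V] [Module ℂ V] (v : Module.Basis ℤ ℂ V)

theorem independent_of_wedge_ne_zero {N : ℕ} {u : Fin N → V} (h : wedge v N u ≠ 0)
    {c : Fin N → ℂ} (hc : ∑ b, c b • u b ∈ lower v (-(N : ℤ))) : c = 0 := by
  obtain ⟨S, hS⟩ := Finsupp.ne_iff.1 h
  have hT : IsTail N S := by
    by_contra hT
    exact hS (wedge_apply_of_not_isTail v u hT)
  rw [wedge_apply_of_isTail v _ hT] at hS
  refine Matrix.eq_zero_of_mulVec_eq_zero hS (funext fun a => ?_)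
  have := (mem_lower_iff v).1 hc _ (hT.lt a)
  simp only [map_sum, map_smul, Finsupp.finsetSum_apply, Finsupp.smul_apply,
    smul_eq_mul] at this
  simpa [Matrix.mulVec, dotProduct, rowMat, mul_comm] using this

/-- The rows with index above `-N` span `ℂ^N`, because a functional that kills them is a linear
relation among the `u_b` modulo `lower (-N)`. Hence `N` of these rows form a basis, and their minor
is nonzero. -/
theorem wedge_ne_zero_of_independent {N : ℕ} {u : Fin N → V}
    (h : ∀ c : Fin N → ℂ, ∑ b, c b • u b ∈ lower v (-(N : ℤ)) → c = 0) : wedge v N u ≠ 0 := by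
  set r : Set.Ioi (-(N : ℤ)) → (Fin N → ℂ) := fun j b => v.repr (u b) j with hr
  have hspan : Submodule.span ℂ (Set.range r) = ⊤ := by
    by_contra hne
    obtain ⟨f, hf0, hf⟩ := Submodule.exists_le_ker_of_lt_top _ (lt_top_iff_ne_top.2 hne)
    have hfc : ∀ x : Fin N → ℂ, f x = ∑ b, x b * f (Pi.single b 1) := by
      intro x
      conv_lhs => rw [← Finset.univ_sum_single x, map_sum]
      refine Finset.sum_congr rfl fun b _ => ?_
      rw [← mul_one (x b), ← smul_eq_mul, Pi.single_smul, map_smul]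
      simp
    refine hf0 ?_
    have hz := h (fun b => f (Pi.single b 1)) ((mem_lower_iff v).2 fun j hj => ?_)
    · refine LinearMap.ext fun x => ?_
      rw [hfc]
      exact Finset.sum_eq_zero fun b _ => by rw [congrFun hz b]; simp
    · have : f (r ⟨j, hj⟩) = 0 := hf (Submodule.subset_span ⟨_, rfl⟩)
      rw [hfc] at this
      simpa [hr, mul_comm] using this
  obtain ⟨κ, a, ha, hs, hli⟩ := exists_linearIndependent' ℂ r
  rw [hspan] at hs
  let bs := Module.Basis.mk hli hs.ge
  have : Finite κ := Module.Finite.finite_basis bs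
  have : Fintype κ := Fintype.ofFinite κ
  have hcard : Fintype.card κ = Fintype.card (Fin N) := by
    rw [← Module.finrank_eq_card_basis bs]; simp
  let e : Fin N ≃ κ := (Fintype.equivOfCardEq hcard).symm
  have hli' : LinearIndependent ℂ fun i : Fin N => r (a (e i)) := hli.comp e e.injective
  obtain ⟨S, hS, σ, hσ⟩ := exists_sort (J := fun i : Fin N => (a (e i) : ℤ))
    (fun i j hij => e.injective (ha (Subtype.ext hij))) fun i => (a (e i)).2
  intro hw
  have h0 := DFunLike.congr_fun hw S
  rw [wedge_apply_of_isTail v _ hS] at h0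
  have h1 : (rowMat v u fun i : Fin N => (a (e i) : ℤ)).det ≠ 0 := by
    have : IsUnit (rowMat v u fun i : Fin N => (a (e i) : ℤ)) :=
      Matrix.linearIndependent_rows_iff_isUnit.1 hli'
    exact ((Matrix.isUnit_iff_isUnit_det _).1 this).ne_zero
  refine h1 ?_
  have h2 : (rowMat v u fun i : Fin N => (a (e i) : ℤ)) =
      (rowMat v u fun i => S.1 i).submatrix σ id := by
    ext i j
    simp [rowMat, hσ]
  rw [h2, Matrix.det_permute, h0]
  simp

/-- The frame is a lift of a basis of `U / lower (-N)`; nonvanishing of the wedge encodes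
independence modulo `lower (-N)`, hence the dimension condition. -/
theorem sato_zero_iff {U : Submodule ℂ V} :
    U ∈ sato v 0 ↔ ∃ (N : ℕ) (u : Fin N → V), U = frameSpan v N u ∧ wedge v N u ≠ 0 := by
  constructor
  · rintro ⟨N, hN, hfin, hrank⟩
    obtain ⟨M, rfl⟩ : ∃ M : ℕ, N = -(M : ℤ) := ⟨(-N).toNat, by omega⟩
    have hr : Module.finrank ℂ (U ⧸ (lower v (-(M : ℤ))).comap U.subtype) = M := by omega
    let b := Module.finBasisOfFinrankEq ℂ _ hr
    choose u hu using fun a => Submodule.Quotient.mk_surjective _ (b a)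
    refine ⟨M, fun a => u a, le_antisymm ?_ ?_, wedge_ne_zero_of_independent v ?_⟩
    · intro x hx
      refine (mem_frameSpan_iff v).2
        ⟨b.repr (Submodule.Quotient.mk (⟨x, hx⟩ : U)), ?_⟩
      have h1 : ((lower v (-(M : ℤ))).comap U.subtype).mkQ ((⟨x, hx⟩ : U) -
          ∑ a, b.repr (Submodule.Quotient.mk (⟨x, hx⟩ : U)) a • u a) = 0 := by
        rw [map_sub, map_sum]
        simp only [map_smul, Submodule.mkQ_apply, hu]
        rw [b.sum_repr, sub_self]
      rw [Submodule.mkQ_apply, Submodule.Quotient.mk_eq_zero] at h1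
      simpa using h1
    · exact frameSpan_le v (fun a => (u a).2) hN
    · intro c hc
      have h1 : ∑ a, c a • b a = 0 := by
        simp only [← hu, ← Submodule.mkQ_apply, ← map_smul]
        rw [← map_sum, Submodule.mkQ_apply, Submodule.Quotient.mk_eq_zero]
        simpa using hc
      exact funext (Fintype.linearIndependent_iff.1 b.linearIndependent c h1)
  · rintro ⟨N, u, rfl, hw⟩
    let f : (Fin N → ℂ) →ₗ[ℂ] frameSpan v N u :=
      Fintype.linearCombination ℂ fun a => (⟨u a, mem_frameSpan v u a⟩ : frameSpan v N u)
    have hf : ∀ c, (f c : V) = ∑ a, c a • u a := by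
      intro c
      simp [f, Fintype.linearCombination_apply]
    set K := (lower v (-(N : ℤ))).comap (frameSpan v N u).subtype with hK
    have hbij : Function.Bijective (K.mkQ ∘ₗ f) := by
      constructor
      · rw [injective_iff_map_eq_zero]
        intro c hc
        rw [LinearMap.comp_apply, Submodule.mkQ_apply, Submodule.Quotient.mk_eq_zero, hK,
          Submodule.mem_comap, Submodule.subtype_apply, hf] at hc
        exact independent_of_wedge_ne_zero v hw hc
      · intro q
        obtain ⟨x, rfl⟩ := K.mkQ_surjective q
        obtain ⟨c, hc⟩ := (mem_frameSpan_iff v).1 x.2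
        refine ⟨c, ?_⟩
        rw [eq_comm, ← sub_eq_zero, LinearMap.comp_apply, ← map_sub, Submodule.mkQ_apply,
          Submodule.Quotient.mk_eq_zero, hK, Submodule.mem_comap, map_sub,
          Submodule.subtype_apply, Submodule.subtype_apply, hf]
        exact hc
    let e := LinearEquiv.ofBijective _ hbij
    refine ⟨-(N : ℤ), lower_le_frameSpan v u, Module.Finite.equiv e, ?_⟩
    rw [← e.finrank_eq]
    simp

theorem wedge_mem_span {N : ℕ} {u u' : Fin N → V} (h : ∀ a, u' a ∈ frameSpan v N u) :
    wedge v N u' ∈ Submodule.span ℂ {wedge v N u} := by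
  choose c hc using fun a => (mem_frameSpan_iff v).1 (h a)
  rw [wedge_comb v (u := u) (G := Matrix.of fun b a => c a b) hc]
  exact Submodule.smul_mem _ _ (Submodule.mem_span_singleton_self _)

theorem pluckerLine_frameSpan {N : ℕ} (u : Fin N → V) :
    pluckerLine v (frameSpan v N u) = Submodule.span ℂ {wedge v N u} := by
  apply le_antisymm
  · rw [pluckerLine, Submodule.span_le]
    rintro φ ⟨u', ⟨N', hu'⟩, hspan, rfl⟩
    have h' : ∀ k, max N N' ≤ k → u' k = v (-(k : ℤ)) :=
      fun k hk => hu' k ((le_max_right _ _).trans hk)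
    rw [SetLike.mem_coe, wedgeSeq_eq v h', ← wedge_extend v (le_max_left N N') u]
    refine wedge_mem_span v fun a => ?_
    rw [frameSpan_extend v (le_max_left N N'), ← hspan]
    exact Submodule.subset_span ⟨_, rfl⟩
  · rw [Submodule.span_singleton_le_iff_mem]
    refine Submodule.subset_span ⟨extend v u, ⟨N, fun k hk => extend_of_ge v u hk⟩, ?_, ?_⟩
    · rw [span_range_eq v fun k hk => extend_of_ge v u hk]
      simp
    · rw [wedgeSeq_eq v fun k hk => extend_of_ge v u hk]
      simp

open Classical in
/-- The Plücker coordinate with rows `J`: up to sign the coordinate at the monomial with the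
indices `J`, and `0` if there is none. -/
def rowFun {N : ℕ} (J : Fin N → ℤ) : Fock →ₗ[ℂ] ℂ :=
  if h : ∃ p : Maya × Equiv.Perm (Fin N), IsTail N p.1 ∧ ∀ a, J a = p.1.1 (p.2 a) then
    ((Equiv.Perm.sign h.choose.2 : ℤ) : ℂ) • Finsupp.lapply h.choose.1
  else 0

/-- This makes every `N × N` minor, for unsorted or repeated rows too, a linear function of the
Plücker vector. Sorting the rows costs the sign; a repeated row gives `0` on both sides. -/
theorem rowFun_wedge {N : ℕ} {J : Fin N → ℤ} (hJ : ∀ a, -(N : ℤ) < J a) (u : Fin N → V) :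
    rowFun J (wedge v N u) = (rowMat v u J).det := by
  rw [rowFun]
  split_ifs with h
  · obtain ⟨h1, h2⟩ := h.choose_spec
    have : rowMat v u J = (rowMat v u fun i => h.choose.1.1 i).submatrix h.choose.2 id := by
      ext i j
      simp only [rowMat, Matrix.of_apply, Matrix.submatrix_apply, id, ← h2]
    rw [this, Matrix.det_permute, LinearMap.smul_apply, Finsupp.lapply_apply,
      wedge_apply_of_isTail v _ h1]
    rfl
  · have hinj : ¬ Function.Injective J := by
      intro hinj
      obtain ⟨S, hS, σ, hσ⟩ := exists_sort hinj hJ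
      exact h ⟨(S, σ), hS, hσ⟩
    simp only [Function.Injective, not_forall] at hinj
    obtain ⟨a, b, hab, hne⟩ := hinj
    rw [LinearMap.zero_apply, Matrix.det_zero_of_row_eq hne]
    funext c
    simp [rowMat, hab]

theorem exists_of_rowFun_ne_zero {N : ℕ} {J : Fin N → ℤ} {φ : Fock} (h : rowFun J φ ≠ 0) :
    ∃ S : Maya, φ S ≠ 0 ∧ (∀ a, ∃ b : Fin N, J a = S.1 b) ∧ ∀ b : Fin N, ∃ a, J a = S.1 b := by
  rw [rowFun] at h
  split_ifs at h with hex
  · obtain ⟨h1, h2⟩ := hex.choose_spec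
    refine ⟨hex.choose.1, fun h0 => h (by simp [h0]), fun a => ⟨_, h2 a⟩,
      fun b => ⟨hex.choose.2.symm b, ?_⟩⟩
    rw [h2, Equiv.apply_symm_apply]
  · exact absurd rfl h

/-- The vector obtained from Plücker coordinates by letting the `b`-th index of `S` vary in
`-N < j ≤ M`. -/
def hat (N : ℕ) (M : ℤ) (S : Maya) (b : Fin N) : Fock →ₗ[ℂ] V :=
  ∑ j ∈ Finset.Ioc (-(N : ℤ)) M,
    (rowFun (Function.update (fun a : Fin N => S.1 a) b j)).smulRight (v j)

theorem repr_hat {N : ℕ} {M : ℤ} {S : Maya} {b : Fin N} (φ : Fock) (j : ℤ) :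
    v.repr (hat v N M S b φ) j =
      if -(N : ℤ) < j ∧ j ≤ M then rowFun (Function.update (fun a : Fin N => S.1 a) b j) φ
      else 0 := by
  simp only [hat, LinearMap.sum_apply, LinearMap.smulRight_apply, map_sum, map_smul,
    Module.Basis.repr_self, Finsupp.finsetSum_apply, Finsupp.smul_apply, Finsupp.single_apply,
    smul_eq_mul, mul_ite, mul_one, mul_zero]
  rw [Finset.sum_ite_eq']
  simp only [Finset.mem_Ioc]

/-- This is Cramer's rule: replacing row `b` of the minor at `S` by the `j`-th coordinates of the
frame gives the `j`-th coordinate of the combination with coefficients from the adjugate. The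
vectors `hat` thus lie in `U`, and they form a frame of `U` when the minor at `S` is nonzero. -/
theorem hat_wedge {N : ℕ} {M : ℤ} {S : Maya} (hS : IsTail N S) {u : Fin N → V}
    (hu : ∀ a, u a ∈ lower v M) (b : Fin N) :
    hat v N M S b (wedge v N u) - ∑ c, (rowMat v u fun a => S.1 a).adjugate c b • u c ∈
      lower v (-(N : ℤ)) := by
  rw [mem_lower_iff]
  intro j hj
  rw [map_sub, Finsupp.sub_apply, sub_eq_zero, repr_hat, map_sum, Finsupp.finsetSum_apply]
  simp only [map_smul, Finsupp.smul_apply, smul_eq_mul]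
  split_ifs with h
  · rw [rowFun_wedge v]
    · have h1 : rowMat v u (Function.update (fun a : Fin N => S.1 a) b j) =
          (rowMat v u fun a => S.1 a).updateRow b fun c => v.repr (u c) j := by
        ext a c
        by_cases hab : a = b
        · subst hab; simp [rowMat]
        · simp [rowMat, Matrix.updateRow_ne hab, Function.update_of_ne hab]
      rw [h1, ← Matrix.cramer_transpose_apply, Matrix.cramer_eq_adjugate_mulVec,
        ← Matrix.adjugate_transpose]
      simp [Matrix.mulVec, dotProduct]
    · intro a
      by_cases hab : a = b
      · subst hab; simpa using hj
      · simpa [Function.update_of_ne hab] using hS.lt a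
  · refine (Finset.sum_eq_zero fun c _ => ?_).symm
    rw [(mem_lower_iff v).1 (hu c) j (by omega), mul_zero]

theorem hat_smul_wedge {N : ℕ} {M : ℤ} {S : Maya} (hS : IsTail N S) {u : Fin N → V}
    (hu : ∀ a, u a ∈ lower v M) (c : ℂ) (b : Fin N) :
    hat v N M S b (c • wedge v N u) -
      ∑ d, (c • (rowMat v u fun a => S.1 a).adjugate) d b • u d ∈ lower v (-(N : ℤ)) := by
  have := Submodule.smul_mem _ c (hat_wedge v hS hu b)
  rw [smul_sub, Finset.smul_sum] at this
  simpa [smul_smul] using this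

theorem exists_isTail_of_wedge_ne_zero {N : ℕ} {u : Fin N → V} (h : wedge v N u ≠ 0) :
    ∃ S : Maya, IsTail N S ∧ wedge v N u S ≠ 0 := by
  obtain ⟨S, hS⟩ := Finsupp.ne_iff.1 h
  refine ⟨S, ?_, hS⟩
  by_contra hT
  exact hS (wedge_apply_of_not_isTail v u hT)

theorem det_smul_adjugate_ne_zero {N : ℕ} {A : Matrix (Fin N) (Fin N) ℂ} (hA : A.det ≠ 0)
    {c : ℂ} (hc : c ≠ 0) : (c • A.adjugate).det ≠ 0 := by
  rw [Matrix.det_smul, Matrix.det_adjugate]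
  exact mul_ne_zero (pow_ne_zero _ hc) (pow_ne_zero _ hA)

theorem frameSpan_hat {N : ℕ} {M : ℤ} {S : Maya} (hS : IsTail N S) {u : Fin N → V}
    (hu : ∀ a, u a ∈ lower v M) (h : wedge v N u S ≠ 0) {c : ℂ} (hc : c ≠ 0) :
    frameSpan v N (fun b => hat v N M S b (c • wedge v N u)) = frameSpan v N u := by
  rw [wedge_apply_of_isTail v _ hS] at h
  exact frameSpan_comb v (hat_smul_wedge v hS hu c) (det_smul_adjugate_ne_zero h hc)

theorem frameSpan_eq_of_wedge_eq {N : ℕ} {u u' : Fin N → V} {c : ℂ} (hne : wedge v N u ≠ 0)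
    (h : wedge v N u = c • wedge v N u') : frameSpan v N u = frameSpan v N u' := by
  obtain ⟨M, hM⟩ := exists_mem_lower_fin v u
  obtain ⟨M', hM'⟩ := exists_mem_lower_fin v u'
  obtain ⟨S, hS, hSne⟩ := exists_isTail_of_wedge_ne_zero v hne
  have hM1 : ∀ a, u a ∈ lower v ((max M M' : ℕ) : ℤ) := fun a => lower_mono v (by simp) (hM a)
  have hM2 : ∀ a, u' a ∈ lower v ((max M M' : ℕ) : ℤ) := fun a => lower_mono v (by simp) (hM' a)
  have hSne' := hSne
  rw [h, Finsupp.smul_apply, smul_eq_mul] at hSne'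
  have h1 := frameSpan_hat v hS hM1 hSne one_ne_zero
  have h2 := frameSpan_hat v hS hM2 (right_ne_zero_of_mul hSne') (left_ne_zero_of_mul hSne')
  rw [one_smul, h] at h1
  rw [← h1, h2]

theorem pluckerLine_injOn : Set.InjOn (pluckerLine v) (sato v 0) := by
  intro U hU U' hU' h
  obtain ⟨N, u, rfl, hu⟩ := (sato_zero_iff v).1 hU
  obtain ⟨N', u', rfl, hu'⟩ := (sato_zero_iff v).1 hU'
  rw [pluckerLine_frameSpan, pluckerLine_frameSpan] at h
  have h1 : wedge v N u ∈ Submodule.span ℂ {wedge v N' u'} := by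
    rw [← h]; exact Submodule.mem_span_singleton_self _
  obtain ⟨c, hc⟩ := Submodule.mem_span_singleton.1 h1
  rw [← frameSpan_extend v (le_max_left N N') u, ← frameSpan_extend v (le_max_right N N') u']
  refine frameSpan_eq_of_wedge_eq v (c := c) ?_ ?_
  · rwa [wedge_extend v (le_max_left N N')]
  · rw [wedge_extend v (le_max_left N N'), wedge_extend v (le_max_right N N'), hc]

/-- A point of the Grassmannian has a frame in the range prescribed by the support of its Plücker
coordinates. -/
theorem exists_bounded_frame {M N : ℕ} (hNM : N ≤ M) {N' : ℤ} {u : Fin M → V}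
    (hne : wedge v M u ≠ 0) (hN : ∀ S, wedge v M u S ≠ 0 → IsTail N S)
    (hN' : ∀ S, wedge v M u S ≠ 0 → ∀ k, S.1 k ≤ N') :
    ∃ u' : Fin N → V, (∀ a, u' a ∈ lower v N') ∧ frameSpan v N u' = frameSpan v M u ∧
      ∃ c : ℂ, c ≠ 0 ∧ wedge v N u' = c • wedge v M u := by
  obtain ⟨L, hL⟩ := exists_mem_lower_fin v u
  obtain ⟨S, hS, hSne⟩ := exists_isTail_of_wedge_ne_zero v hne
  set φ := wedge v M u with hφ
  set d := φ S with hd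
  have hdet : d = (rowMat v u fun a => S.1 a).det := wedge_apply_of_isTail v _ hS
  -- A nonzero coordinate at `j` exhibits a monomial in the support of `φ` that contains the index
  -- `j`.
  have hlow : ∀ b, hat v M L S b φ ∈ lower v N' := by
    intro b
    rw [mem_lower_iff]
    intro j hj
    rw [repr_hat]
    split_ifs with h
    · by_contra h0
      obtain ⟨T, hT, h1, -⟩ := exists_of_rowFun_ne_zero h0
      obtain ⟨c, hc⟩ := h1 b
      rw [Function.update_self] at hc
      have := hN' T hT c
      omega
    · rfl
  -- Every monomial in the support of `φ` contains `-b`, so replacing the index `-b` of `S` by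
  -- anything else gives coordinate `0`. The frame vectors from position `N` on are therefore `d •
  -- v_{-b}`, and can be dropped after division by `d`.
  have htail : ∀ b : Fin M, N ≤ (b : ℕ) →
      hat v M L S b φ - d • v (-(b : ℤ)) ∈ lower v (-(M : ℤ)) := by
    intro b hb
    have hSb : S.1 b = -(b : ℤ) := hN S hSne b hb
    rw [mem_lower_iff]
    intro j hj
    rw [map_sub, Finsupp.sub_apply, sub_eq_zero, repr_hat, map_smul, Finsupp.smul_apply,
      Module.Basis.repr_self, smul_eq_mul]
    by_cases hjb : j = -(b : ℤ)
    · subst hjb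
      rw [if_pos ⟨hj, by omega⟩, Finsupp.single_eq_same, mul_one, ← hSb,
        Function.update_eq_self, rowFun_wedge v hS.lt, hdet]
    · rw [Finsupp.single_eq_of_ne hjb, mul_zero]
      split_ifs with h
      · by_contra h0
        obtain ⟨T, hT, -, h2⟩ := exists_of_rowFun_ne_zero h0
        obtain ⟨a, ha⟩ := h2 b
        rw [hN T hT b hb] at ha
        by_cases hab : a = b
        · subst hab
          rw [Function.update_self] at ha
          exact hjb ha
        · rw [Function.update_of_ne hab, ← hSb] at ha
          exact hab (Fin.ext (S.2.1.injective ha))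
      · rfl
  set u' : Fin N → V := fun a => d⁻¹ • hat v M L S (Fin.castLE hNM a) φ with hu'
  have hcomb : ∀ b : Fin M, extend v u' b -
      ∑ c, (d⁻¹ • (rowMat v u fun a => S.1 a).adjugate) c b • u c ∈ lower v (-(M : ℤ)) := by
    intro b
    have h1 := Submodule.smul_mem _ d⁻¹ (hat_wedge v hS hL b)
    rw [smul_sub, Finset.smul_sum] at h1
    simp only [smul_smul] at h1
    simp only [Matrix.smul_apply, smul_eq_mul]
    by_cases hb : (b : ℕ) < N
    · have : extend v u' b = d⁻¹ • hat v M L S b φ := by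
        rw [extend, dif_pos hb]
        rfl
      rw [this]
      exact h1
    · rw [extend_of_ge v u' (not_lt.1 hb)]
      have h2 := Submodule.smul_mem _ d⁻¹ (htail b (not_lt.1 hb))
      rw [smul_sub, smul_smul, inv_mul_cancel₀ hSne, one_smul] at h2
      have := sub_mem h1 h2
      convert this using 1
      abel
  have hG : (d⁻¹ • (rowMat v u fun a => S.1 a).adjugate).det ≠ 0 :=
    det_smul_adjugate_ne_zero (hdet ▸ hSne) (inv_ne_zero hSne)
  refine ⟨u', fun a => Submodule.smul_mem _ _ (hlow _), ?_, _, hG, ?_⟩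
  · rw [← frameSpan_extend v hNM u', frameSpan_comb v hcomb hG]
  · rw [← wedge_extend v hNM u', wedge_comb v hcomb]

end Plucker

/-! ### Operators induced on Fock space, and the exponential of a square-zero operator. -/

theorem coeff_eq_of_forall_sum_pow_smul_eq {n : ℕ} {a b : ℕ → Fock}
    (h : ∀ s : ℂ, ∑ k ∈ Finset.range n, s ^ k • a k = ∑ k ∈ Finset.range n, s ^ k • b k)
    {k : ℕ} (hk : k < n) : a k = b k := by
  ext S
  have key : (∑ k ∈ Finset.range n, Polynomial.monomial k (a k S) : Polynomial ℂ) =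
      ∑ k ∈ Finset.range n, Polynomial.monomial k (b k S) := by
    refine Polynomial.funext fun s => ?_
    have := DFunLike.congr_fun (h s) S
    simp only [Finsupp.finsetSum_apply, Finsupp.smul_apply, smul_eq_mul] at this
    simpa [Polynomial.eval_finsetSum, mul_comm] using this
  have := congrArg (fun p => Polynomial.coeff p k) key
  simpa [Polynomial.finsetSum_coeff, Polynomial.coeff_monomial, hk] using this

section Group

variable {V : Type*} [AddCommGroup V] [Module ℂ V] (v : Module.Basis ℤ ℂ V)

/-- The operator on `F^(0)` induced by an operator on `V` that fixes `v_j` for `j ≪ 0`: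
`v_{i 0} ∧ v_{i 1} ∧ … ↦ g v_{i 0} ∧ g v_{i 1} ∧ …`. -/
def gact (g : V →ₗ[ℂ] V) : Module.End ℂ Fock :=
  Finsupp.linearCombination ℂ fun S : Maya => wedgeSeq v fun k => g (v (S.1 k))

theorem gact_single {N : ℕ} {g : V →ₗ[ℂ] V} (hg : ∀ j, j ≤ -(N : ℤ) → g (v j) = v j) {S : Maya}
    (hS : IsTail N S) : gact v g (Finsupp.single S 1) = wedge v N fun a => g (v (S.1 a)) := by
  rw [gact, Finsupp.linearCombination_single, one_smul]
  refine wedgeSeq_eq v fun k hk => ?_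
  rw [hS k hk, hg _ (by omega)]

/-- Both sides are alternating in `u` and vanish when some `u a` is a `v_j` with `j ≤ -N`, so
monomials suffice. -/
theorem gact_wedge {N : ℕ} {g : V →ₗ[ℂ] V} (hg : ∀ j, j ≤ -(N : ℤ) → g (v j) = v j)
    (u : Fin N → V) : gact v g (wedge v N u) = wedge v N fun a => g (u a) := by
  have : (gact v g).compAlternatingMap (wedgeAlt v N) = (wedgeAlt v N).compLinearMap g := by
    refine alternating_ext v ?_ ?_
    · intro u a j hj hu
      constructor
      · rw [LinearMap.compAlternatingMap_apply, wedgeAlt_apply,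
          wedge_eq_zero_of_mem_lower v a (hu ▸ basis_mem_lower v hj), map_zero]
      · rw [AlternatingMap.compLinearMap_apply, wedgeAlt_apply]
        refine wedge_eq_zero_of_mem_lower v a ?_
        rw [hu, hg j hj]
        exact basis_mem_lower v hj
    · intro S hS
      rw [LinearMap.compAlternatingMap_apply, wedgeAlt_apply, wedge_maya v hS, gact_single v hg hS]
      rfl
  exact DFunLike.congr_fun this u

theorem gact_gact {N : ℕ} {g h : V →ₗ[ℂ] V} (hg : ∀ j, j ≤ -(N : ℤ) → g (v j) = v j)
    (hh : ∀ j, j ≤ -(N : ℤ) → h (v j) = v j) (φ : Fock) :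
    gact v g (gact v h φ) = gact v (g ∘ₗ h) φ := by
  rw [← LinearMap.comp_apply]
  refine LinearMap.congr_fun (Finsupp.lhom_ext' fun S => LinearMap.ext_ring ?_) φ
  obtain ⟨M, hM⟩ := exists_isTail S
  have hm := hM.mono (le_max_left M N)
  have hg' : ∀ j, j ≤ -((max M N : ℕ) : ℤ) → g (v j) = v j := fun j hj => hg j (by omega)
  have hh' : ∀ j, j ≤ -((max M N : ℕ) : ℤ) → h (v j) = v j := fun j hj => hh j (by omega)
  simp only [LinearMap.comp_apply, Finsupp.lsingle_apply]
  rw [gact_single v hh' hm, gact_wedge v hg', gact_single v _ hm]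
  · rfl
  · intro j hj
    rw [LinearMap.comp_apply, hh' j hj, hg' j hj]

open Finset in
theorem wedge_add_smul {N : ℕ} (u x : Fin N → V) (s : ℂ) :
    wedge v N (fun a => u a + s • x a) =
      ∑ k ∈ range (N + 1), s ^ k • ∑ T ∈ powersetCard k univ, wedge v N (T.piecewise x u) := by
  have h1 : wedge v N (fun a => u a + s • x a) =
      ∑ T : Finset (Fin N), s ^ #T • wedge v N (T.piecewise x u) := by
    have h := (wedgeAlt v N).map_add_univ (fun a => s • x a) u
    have h2 : ((fun a => s • x a) + u) = fun a => u a + s • x a := by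
      funext a; exact add_comm _ _
    rw [h2] at h
    rw [← wedgeAlt_apply, h]
    refine sum_congr rfl fun T _ => ?_
    have h3 := (wedgeAlt v N).toMultilinearMap.map_piecewise_smul (fun _ => s) (T.piecewise x u) T
    rw [prod_const] at h3
    rw [← wedgeAlt_apply]
    refine Eq.trans (congrArg (wedgeAlt v N) (funext fun a => ?_)) h3
    by_cases ha : a ∈ T <;> simp [ha]
  rw [h1, ← powerset_univ, sum_powerset, card_univ, Fintype.card_fin]
  refine sum_congr rfl fun k _ => ?_
  rw [smul_sum]
  refine sum_congr rfl fun T hT => ?_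
  rw [(mem_powersetCard.1 hT).2]

theorem derivAct_single {N : ℕ} {A : V →ₗ[ℂ] V} (hA : ∀ j, j ≤ -(N : ℤ) → A (v j) = 0) {S : Maya}
    (hS : IsTail N S) : derivAct v A (Finsupp.single S 1) =
      ∑ a : Fin N, wedge v N (Function.update (fun b : Fin N => v (S.1 b)) a (A (v (S.1 a)))) := by
  rw [derivAct, Finsupp.linearCombination_single, one_smul]
  rw [finsum_eq_sum_of_support_subset (s := Finset.range N), Finset.sum_range]
  · refine Finset.sum_congr rfl fun a _ => ?_
    rw [wedgeSeq_eq v (N := N)]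
    · congr 1
      funext b
      by_cases hab : b = a
      · subst hab; simp
      · rw [Function.update_of_ne hab, Function.update_of_ne (fun h => hab (Fin.ext h))]
    · intro k hk
      rw [Function.update_of_ne (by have := a.2; omega), hS k hk]
  · intro k hk
    by_contra hkN
    simp only [Finset.coe_range, Set.mem_Iio, not_lt] at hkN
    refine hk ?_
    dsimp only
    rw [hS k hkN, hA _ (by omega), wedgeSeq_eq v (N := k + 1)]
    · rw [← wedgeAlt_apply]
      exact AlternatingMap.map_coord_zero _ (Fin.last k) (by simp)
    · intro l hl
      rw [Function.update_of_ne (by omega), hS l (by omega)]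

open Finset in
-- On a monomial, `Γ k` sums the ways to apply `A` in `k` positions. Since `A` kills `v_j` outside
-- `F`, at most `#F` positions contribute, a bound uniform in the monomial. The range has length `#F
-- + 2` so that index `1` occurs even for empty `F`.
theorem exists_gact_coeff {A : V →ₗ[ℂ] V} {F : Finset ℤ} (hF : ∀ j ∉ F, A (v j) = 0) :
    ∃ Γ : ℕ → Module.End ℂ Fock, (∀ k, #F < k → Γ k = 0) ∧ Γ 1 = derivAct v A ∧
      ∀ (s : ℂ) φ, gact v (LinearMap.id + s • A) φ = ∑ k ∈ range (#F + 2), s ^ k • Γ k φ := by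
  obtain ⟨m, hm⟩ := F.bddBelow
  have hlow : ∀ j, j ≤ -(((1 - m).toNat : ℕ) : ℤ) → A (v j) = 0 := by
    intro j hj
    refine hF j fun hjF => ?_
    have := hm hjF
    omega
  have key : ∀ S : Maya, ∃ c : ℕ → Fock, (∀ k, #F < k → c k = 0) ∧
      c 1 = derivAct v A (Finsupp.single S 1) ∧ ∀ s : ℂ,
      gact v (LinearMap.id + s • A) (Finsupp.single S 1) = ∑ k ∈ range (#F + 2), s ^ k • c k := by
    intro S
    obtain ⟨N, hN, hlowN⟩ : ∃ N : ℕ, IsTail N S ∧ ∀ j, j ≤ -(N : ℤ) → A (v j) = 0 := by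
      obtain ⟨M, hM⟩ := exists_isTail S
      exact ⟨max M (1 - m).toNat, hM.mono (le_max_left _ _), fun j hj => hlow j (by omega)⟩
    set u : Fin N → V := fun a => v (S.1 a) with hu
    set c : ℕ → Fock := fun k =>
      ∑ T ∈ powersetCard k univ, wedge v N (T.piecewise (fun a => A (u a)) u) with hc
    have hc0 : ∀ k, #F < k → c k = 0 := by
      intro k hk
      refine sum_eq_zero fun T hT => ?_
      obtain ⟨a, haT, ha⟩ : ∃ a ∈ T, S.1 a ∉ F := by
        by_contra! hcon
        have h1 : #T ≤ #F := card_le_card_of_injOn (fun a : Fin N => S.1 a) hcon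
          fun a _ b _ hab => Fin.ext (S.2.1.injective hab)
        have := (mem_powersetCard.1 hT).2
        omega
      refine (wedgeAlt v N).map_coord_zero a ?_
      rw [piecewise_eq_of_mem _ _ _ haT, hu, hF _ ha]
    have hcN : ∀ k, N < k → c k = 0 := by
      intro k hk
      have : powersetCard k (univ : Finset (Fin N)) = ∅ := powersetCard_eq_empty.2 (by simpa)
      simp [hc, this]
    refine ⟨c, hc0, ?_, fun s => ?_⟩
    · rw [derivAct_single v hlowN hN]
      simp only [hc, powersetCard_one, sum_map, Function.Embedding.coeFn_mk, piecewise_singleton]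
      rfl
    · rw [gact_single v (N := N) (fun j hj => by simp [hlowN j hj]) hN]
      have h1 := wedge_add_smul v u (fun a => A (u a)) s
      simp only [LinearMap.add_apply, LinearMap.id_apply, LinearMap.smul_apply]
      refine h1.trans ?_
      change ∑ k ∈ range (N + 1), s ^ k • c k = _
      -- Both truncations, at `N + 1` and at `#F + 2`, are padded with zeros to the larger one.
      have h2 : ∀ n, (∀ k, n ≤ k → c k = 0) → ∑ k ∈ range n, s ^ k • c k =
          ∑ k ∈ range (max (N + 1) (#F + 2)), s ^ k • c k ∨ max (N + 1) (#F + 2) < n := by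
        intro n hn
        rcases le_or_gt n (max (N + 1) (#F + 2)) with h | h
        · refine Or.inl (sum_subset (range_mono h) fun k _ hk => ?_)
          rw [hn k (by simpa using hk), smul_zero]
        · exact Or.inr h
      have h3 := h2 (N + 1) fun k hk => hcN k hk
      have h4 := h2 (#F + 2) fun k hk => hc0 k (by omega)
      rw [h3.resolve_right (not_lt.2 (le_max_left _ _)),
        h4.resolve_right (not_lt.2 (le_max_right _ _))]
  choose c hc0 hc1 hc using key
  refine ⟨fun k => Finsupp.linearCombination ℂ fun S => c S k, ?_, ?_, ?_⟩
  · intro k hk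
    refine Finsupp.lhom_ext' fun S => LinearMap.ext_ring ?_
    simp [hc0 S k hk]
  · refine Finsupp.lhom_ext' fun S => LinearMap.ext_ring ?_
    simp [hc1 S]
  · intro s φ
    have : gact v (LinearMap.id + s • A) = ∑ k ∈ range (#F + 2),
        s ^ k • Finsupp.linearCombination ℂ fun S => c S k := by
      refine Finsupp.lhom_ext' fun S => LinearMap.ext_ring ?_
      simp only [LinearMap.comp_apply, Finsupp.lsingle_apply, LinearMap.sum_apply,
        LinearMap.smul_apply, hc S s, Finsupp.linearCombination_single, one_smul]
    rw [this]
    simp only [LinearMap.sum_apply, LinearMap.smul_apply]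

open Finset in
-- As `A² = 0`, the operators `1 + s A` form a one-parameter group, polynomial in `s` on Fock space
-- with linear coefficient `derivAct v A`. Such a group is the exponential of its linear
-- coefficient.
theorem derivAct_isNilpotent_and_exp {A : V →ₗ[ℂ] V} (hAA : A ∘ₗ A = 0)
    {F : Finset ℤ} (hF : ∀ j ∉ F, A (v j) = 0) :
    IsNilpotent (derivAct v A) ∧
      IsNilpotent.exp (derivAct v A) = gact v (LinearMap.id + A) := by
  obtain ⟨Γ, h0, h1, hΓ⟩ := exists_gact_coeff v hF
  obtain ⟨m, hm⟩ := F.bddBelow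
  have hfix : ∀ (s : ℂ) j, j ≤ -(((1 - m).toNat : ℕ) : ℤ) →
      (LinearMap.id + s • A : V →ₗ[ℂ] V) (v j) = v j := by
    intro s j hj
    have : A (v j) = 0 := by
      refine hF j fun hjF => ?_
      have := hm hjF
      omega
    simp [this]
  have hmul : ∀ (s t : ℂ) φ, gact v (LinearMap.id + s • A) (gact v (LinearMap.id + t • A) φ) =
      gact v (LinearMap.id + (s + t) • A) φ := by
    intro s t φ
    rw [gact_gact v (hfix s) (hfix t)]
    congr 2
    rw [LinearMap.add_comp, LinearMap.id_comp, LinearMap.comp_add, LinearMap.comp_id,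
      LinearMap.smul_comp, LinearMap.comp_smul, hAA, add_smul]
    simp only [smul_zero, add_zero]
    abel
  have hrec : ∀ k φ, Γ k (Γ 1 φ) = (k + 1) • Γ (k + 1) φ := by
    intro k φ
    -- The coefficient of `t` in the group law `g(s) g(t) = g(s + t)`; comparing powers of `s`
    -- afterwards gives the recursion.
    have hs : ∀ s : ℂ, gact v (LinearMap.id + s • A) (Γ 1 φ) =
        ∑ k ∈ range (#F + 2), ((k : ℂ) * s ^ (k - 1)) • Γ k φ := by
      intro s
      have h2 := coeff_eq_of_forall_sum_pow_smul_eq (n := #F + 2)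
        (a := fun l => gact v (LinearMap.id + s • A) (Γ l φ))
        (b := fun l => ∑ k ∈ range (#F + 2), ((k.choose l : ℂ) * s ^ (k - l)) • Γ k φ)
        (fun t => ?_) (k := 1) (by omega)
      · simpa using h2
      · have h3 := hmul s t φ
        rw [hΓ t φ, map_sum, hΓ] at h3
        simp only [map_smul] at h3
        rw [h3]
        simp only [smul_sum, smul_smul]
        rw [sum_comm]
        refine sum_congr rfl fun k hk => ?_
        rw [← sum_smul]
        congr 1
        rw [add_comm s t, add_pow]
        refine Eq.trans (sum_congr rfl fun l _ => ?_)
          (sum_subset (range_mono (by have := mem_range.1 hk; omega)) ?_)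
        · ring
        · intro l _ hl
          rw [Nat.choose_eq_zero_of_lt (by simpa using hl)]
          simp
    rcases lt_or_ge k (#F + 2) with hk | hk
    · refine (coeff_eq_of_forall_sum_pow_smul_eq (n := #F + 2) (a := fun k => Γ k (Γ 1 φ))
        (b := fun k => (k + 1) • Γ (k + 1) φ) (fun s => ?_) hk)
      rw [← hΓ s (Γ 1 φ), hs s, sum_range_succ', sum_range_succ _ (#F + 1)]
      rw [h0 (#F + 1 + 1) (by omega)]
      simp only [LinearMap.zero_apply, smul_zero, Nat.cast_zero, zero_mul, zero_smul]
      congr 1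
      refine sum_congr rfl fun k _ => ?_
      rw [← Nat.cast_smul_eq_nsmul ℂ, smul_smul, mul_comm]
      simp
    · rw [h0 k (by omega), h0 (k + 1) (by omega)]
      simp
  have hone : Γ 0 = 1 := by
    refine LinearMap.ext fun φ => ?_
    have := hΓ 0 φ
    rw [sum_range_succ', sum_eq_zero (fun k _ => by simp), zero_add, pow_zero, one_smul] at this
    rw [← this, zero_smul, add_zero]
    have h3 : gact v (LinearMap.id : V →ₗ[ℂ] V) = 1 := by
      refine Finsupp.lhom_ext' fun S => LinearMap.ext_ring ?_
      obtain ⟨N, hN⟩ := exists_isTail S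
      simp only [LinearMap.comp_apply, Finsupp.lsingle_apply]
      rw [gact_single v (N := N) (fun j _ => rfl) hN]
      exact wedge_maya v hN
    rw [h3]
  have hpow : ∀ k, (derivAct v A) ^ k = k.factorial • Γ k := by
    intro k
    induction k with
    | zero => simp [hone]
    | succ k ih =>
      rw [pow_succ, ih, ← h1]
      refine LinearMap.ext fun φ => ?_
      simp only [Module.End.mul_apply, LinearMap.smul_apply, hrec, smul_smul]
      rw [Nat.factorial_succ, mul_comm]
  have hnil : (derivAct v A) ^ (#F + 2) = 0 := by
    rw [hpow, h0 _ (by omega), smul_zero]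
  refine ⟨⟨_, hnil⟩, ?_⟩
  rw [IsNilpotent.exp_eq_sum hnil]
  refine LinearMap.ext fun φ => ?_
  have := hΓ 1 φ
  rw [one_smul] at this
  rw [this, LinearMap.sum_apply]
  refine sum_congr rfl fun k _ => ?_
  rw [hpow, one_pow, one_smul, ← Nat.cast_smul_eq_nsmul ℚ k.factorial (Γ k), smul_smul,
    inv_mul_cancel₀ (by exact_mod_cast k.factorial_ne_zero), one_smul]

end Group

/-! ### Homogeneous polynomials and closed sets in `ℙ(L)`. -/

section Zariski

theorem eval_smul_of_isHomogeneous {σ : Type*} {f : MvPolynomial σ ℂ} {d : ℕ}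
    (hf : f.IsHomogeneous d) (a : ℂ) (x : σ → ℂ) :
    MvPolynomial.eval (a • x) f = a ^ d * MvPolynomial.eval x f := by
  rw [MvPolynomial.eval_eq, MvPolynomial.eval_eq, Finset.mul_sum]
  refine Finset.sum_congr rfl fun m hm => ?_
  have h := hf (MvPolynomial.mem_support_iff.1 hm)
  simp only [Finsupp.weight_apply, Finsupp.sum, Pi.one_apply, smul_eq_mul, mul_one] at h
  simp only [Pi.smul_apply, smul_eq_mul, mul_pow, Finset.prod_mul_distrib,
    Finset.prod_pow_eq_pow_sum, h]
  ring

variable {L : Type*} [AddCommGroup L] [Module ℂ L]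

/-- `F` is a homogeneous polynomial of degree `d` in linear forms on `L`. -/
def IsHomPoly (d : ℕ) (F : L → ℂ) : Prop :=
  ∃ f : MvPolynomial (Module.Dual ℂ L) ℂ, f.IsHomogeneous d ∧
    ∀ x, MvPolynomial.eval (fun l : Module.Dual ℂ L => l x) f = F x

theorem IsHomPoly.linear {F : L → ℂ} (l : L →ₗ[ℂ] ℂ) (h : ∀ x, l x = F x) : IsHomPoly 1 F :=
  ⟨MvPolynomial.X l, MvPolynomial.isHomogeneous_X _ _, fun x => by simp [h]⟩

theorem IsHomPoly.const (c : ℂ) : IsHomPoly 0 fun _ : L => c :=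
  ⟨MvPolynomial.C c, MvPolynomial.isHomogeneous_C _ _, fun x => by simp⟩

theorem IsHomPoly.zero (d : ℕ) : IsHomPoly d fun _ : L => 0 :=
  ⟨0, MvPolynomial.isHomogeneous_zero _ _ _, fun x => by simp⟩

theorem IsHomPoly.sum {ι : Type*} {s : Finset ι} {d : ℕ} {F : ι → L → ℂ}
    (h : ∀ i, IsHomPoly d (F i)) : IsHomPoly d fun x => ∑ i ∈ s, F i x := by
  choose f hf hF using h
  exact ⟨∑ i ∈ s, f i, MvPolynomial.IsHomogeneous.sum _ _ _ fun i _ => hf i, fun x => by simp [hF]⟩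

theorem IsHomPoly.mul {d e : ℕ} {F G : L → ℂ} (hF : IsHomPoly d F) (hG : IsHomPoly e G) :
    IsHomPoly (d + e) fun x => F x * G x := by
  obtain ⟨f, hf, hF⟩ := hF
  obtain ⟨g, hg, hG⟩ := hG
  exact ⟨f * g, hf.mul hg, fun x => by simp [hF, hG]⟩

theorem IsHomPoly.const_mul {d : ℕ} {F : L → ℂ} (c : ℂ) (hF : IsHomPoly d F) :
    IsHomPoly d fun x => c * F x := by
  simpa using (IsHomPoly.const c).mul hF

theorem IsHomPoly.sub {d : ℕ} {F G : L → ℂ} (hF : IsHomPoly d F) (hG : IsHomPoly d G) :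
    IsHomPoly d fun x => F x - G x := by
  obtain ⟨f, hf, hF⟩ := hF
  obtain ⟨g, hg, hG⟩ := hG
  exact ⟨f - g, hf.sub hg, fun x => by simp [hF, hG]⟩

theorem IsHomPoly.prod {ι : Type*} {s : Finset ι} {F : ι → L → ℂ}
    (h : ∀ i, IsHomPoly 1 (F i)) : IsHomPoly s.card fun x => ∏ i ∈ s, F i x := by
  choose f hf hF using h
  refine ⟨∏ i ∈ s, f i, ?_, fun x => by simp [hF]⟩
  simpa using MvPolynomial.IsHomogeneous.prod s f (fun _ => 1) fun i _ => hf i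

theorem IsHomPoly.pow {F : L → ℂ} (h : IsHomPoly 1 F) (n : ℕ) :
    IsHomPoly n fun x => F x ^ n := by
  simpa using IsHomPoly.prod (s := Finset.range n) fun _ => h

theorem isIndClosed_of_forall_isHomPoly {Z : Set (ℙ ℂ L)}
    (h : ∀ E : Submodule ℂ L, Module.Finite ℂ E → ∃ Q : Set (L → ℂ),
      (∀ F ∈ Q, ∃ d, IsHomPoly d F) ∧ ∀ p : ℙ ℂ L, p.rep ∈ E → (p ∈ Z ↔ ∀ F ∈ Q, F p.rep = 0)) :
    IsIndClosed Z := by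
  intro E hE
  obtain ⟨Q, hQ, hZ⟩ := h E hE
  choose! d f hf hF using hQ
  refine ⟨f '' Q, ?_, fun p hp => ?_⟩
  · rintro _ ⟨F, hFQ, rfl⟩
    exact ⟨_, hf F hFQ⟩
  · rw [Projectivization.submodule_eq, Submodule.span_singleton_le_iff_mem] at hp
    rw [hZ p hp, Set.forall_mem_image]
    exact forall₂_congr fun F hFQ => by rw [hF F hFQ]

theorem mem_closure_iff_of_isIndClosed {Z : Set (ℙ ℂ L)} {p : ℙ ℂ L} :
    p ∈ @closure _ (indZariski L) Z ↔ ∀ T, IsIndClosed T → Z ⊆ T → p ∈ T := by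
  let _ := indZariski L
  have hc : ∀ T : Set (ℙ ℂ L), IsClosed T ↔ IsIndClosed T := fun T => by
    rw [← isOpen_compl_iff]
    change IsIndClosed (Tᶜᶜ) ↔ _
    rw [compl_compl]
  simp only [closure, Set.mem_sInter, Set.mem_ofPred_eq, and_imp, hc]

theorem isIndClosed_closure (Z : Set (ℙ ℂ L)) : IsIndClosed (@closure _ (indZariski L) Z) := by
  let _ := indZariski L
  have h : IsOpen (closure Z)ᶜ := isClosed_closure.isOpen_compl
  change IsIndClosed ((closure Z)ᶜᶜ) at h
  rwa [compl_compl] at h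

theorem subset_closure_indZariski (Z : Set (ℙ ℂ L)) : Z ⊆ @closure _ (indZariski L) Z :=
  @subset_closure _ (indZariski L) Z

theorem polynomial_eq_zero_of_eval {q : Polynomial ℂ} (h : ∀ s : ℂ, s ≠ 0 → q.eval s = 0) :
    q = 0 := by
  have : Polynomial.X * q = 0 := Polynomial.funext fun s => by
    rcases eq_or_ne s 0 with rfl | hs
    · simp
    · simp [h s hs]
  exact (mul_eq_zero.1 this).resolve_left Polynomial.X_ne_zero

/-- A closed set that contains the points of a polynomial curve other than the one at `0` contains
the one at `0`. -/
theorem mk_mem_of_curve {Z : Set (ℙ ℂ L)} (hZ : IsIndClosed Z) {n : ℕ} (c : ℕ → L)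
    (hne : ∀ s : ℂ, ∑ k ∈ Finset.range n, s ^ k • c k ≠ 0)
    (h : ∀ s : ℂ, s ≠ 0 → Projectivization.mk ℂ _ (hne s) ∈ Z) :
    Projectivization.mk ℂ _ (hne 0) ∈ Z := by
  set x : ℂ → L := fun s => ∑ k ∈ Finset.range n, s ^ k • c k with hx
  set E := Submodule.span ℂ (c '' Finset.range n) with hE
  have hfin : Module.Finite ℂ E :=
    FiniteDimensional.span_of_finite ℂ ((Finset.range n).finite_toSet.image c)
  have hxE : ∀ s, x s ∈ E := fun s => Submodule.sum_mem _ fun k hk =>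
    Submodule.smul_mem _ _ (Submodule.subset_span ⟨k, hk, rfl⟩)
  have hle : ∀ s, (Projectivization.mk ℂ _ (hne s)).submodule ≤ E := fun s => by
    rw [Projectivization.submodule_mk, Submodule.span_singleton_le_iff_mem]
    exact hxE s
  obtain ⟨P, hP, hPZ⟩ := hZ E hfin
  have hscale : ∀ f ∈ P, ∀ s, MvPolynomial.eval
      (fun l : Module.Dual ℂ L => l (Projectivization.mk ℂ _ (hne s)).rep) f = 0 ↔
      MvPolynomial.eval (fun l : Module.Dual ℂ L => l (x s)) f = 0 := by
    intro f hf s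
    obtain ⟨d, hd⟩ := hP f hf
    obtain ⟨a, ha⟩ := Projectivization.exists_smul_eq_mk_rep ℂ _ (hne s)
    have h1 : (fun l : Module.Dual ℂ L => l (Projectivization.mk ℂ _ (hne s)).rep) =
        (a : ℂ) • fun l : Module.Dual ℂ L => l (x s) := by
      funext l
      rw [← ha, Units.smul_def, map_smul]
      rfl
    rw [h1, eval_smul_of_isHomogeneous hd]
    simp
  rw [hPZ _ (hle 0)]
  intro f hf
  rw [hscale f hf]
  -- `f` pulled back to the curve: a polynomial in `s` that vanishes for `s ≠ 0`, hence identically.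
  -- By homogeneity (`hscale`) the chosen representatives do not matter.
  set q : Polynomial ℂ := MvPolynomial.aeval (fun l : Module.Dual ℂ L =>
    (∑ k ∈ Finset.range n, Polynomial.monomial k (l (c k)) : Polynomial ℂ)) f with hq
  have hqe : ∀ s, q.eval s = MvPolynomial.eval (fun l : Module.Dual ℂ L => l (x s)) f := by
    intro s
    rw [hq, ← Polynomial.coe_evalRingHom, MvPolynomial.aeval_def, MvPolynomial.hom_eval₂,
      ← MvPolynomial.eval₂_id]
    congr 1
    · ext z; simp
    · funext l
      simp [hx, mul_comm]
  have hq0 : q = 0 := polynomial_eq_zero_of_eval fun s hs => by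
    rw [hqe, ← hscale f hf]
    exact (hPZ _ (hle s)).1 (h s hs) f hf
  rw [← hqe, hq0, Polynomial.eval_zero]

end Zariski

/-! ### Closed conditions on the Grassmannian, and limits of sheared subspaces. -/

section Fock

variable {L : Submodule ℂ Fock}

/-- The version of `mk_mem_of_curve` for a curve given in the ambient Fock space. -/
theorem exists_mem_of_curve {Z : Set (ℙ ℂ L)} (hZ : IsIndClosed Z) {n : ℕ} (c : ℕ → Fock)
    (hne : ∀ s : ℂ, ∑ k ∈ Finset.range n, s ^ k • c k ≠ 0)
    (h : ∀ s : ℂ, s ≠ 0 → ∃ p ∈ Z, p.submodule.map L.subtype =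
      Submodule.span ℂ {∑ k ∈ Finset.range n, s ^ k • c k}) :
    ∃ p ∈ Z, p.submodule.map L.subtype =
      Submodule.span ℂ {∑ k ∈ Finset.range n, (0 : ℂ) ^ k • c k} := by
  -- The coefficients `c k` are not known to lie in `L`; only the points with `s ≠ 0` are.
  -- Projecting the coefficients leaves the curve unchanged for `s ≠ 0`, hence also at `s = 0`.
  obtain ⟨π, hπ⟩ : ∃ π : Fock →ₗ[ℂ] L, π ∘ₗ L.subtype = LinearMap.id :=
    LinearMap.exists_leftInverse_of_injective (K := ℂ) (V := L) (V' := Fock) L.subtype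
      L.ker_subtype
  have hπL : ∀ x : L, π x = x := fun x => LinearMap.congr_fun hπ x
  have hmem : ∀ s : ℂ, s ≠ 0 → ∑ k ∈ Finset.range n, s ^ k • c k ∈ L := by
    intro s hs
    obtain ⟨p, -, hp⟩ := h s hs
    have h1 : ∑ k ∈ Finset.range n, s ^ k • c k ∈ p.submodule.map L.subtype := by
      rw [hp]; exact Submodule.mem_span_singleton_self _
    exact Submodule.map_subtype_le _ _ h1
  have hcoe : ∀ s : ℂ, ((∑ k ∈ Finset.range n, s ^ k • π (c k) : L) : Fock) =
      ∑ k ∈ Finset.range n, s ^ k • c k := by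
    have hs0 : ∀ s : ℂ, s ≠ 0 → ((∑ k ∈ Finset.range n, s ^ k • π (c k) : L) : Fock) =
        ∑ k ∈ Finset.range n, s ^ k • c k := by
      intro s hs
      have := hπL ⟨_, hmem s hs⟩
      simp only [map_sum, map_smul] at this
      rw [this]
    intro s
    ext S
    have hq : (∑ k ∈ Finset.range n,
        Polynomial.monomial k ((π (c k) : Fock) S - c k S) : Polynomial ℂ) = 0 := by
      refine polynomial_eq_zero_of_eval fun s hs => ?_
      have := DFunLike.congr_fun (hs0 s hs) S
      simp only [Submodule.coe_sum, Submodule.coe_smul, Finsupp.finsetSum_apply,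
        Finsupp.smul_apply, smul_eq_mul] at this
      rw [← sub_eq_zero, ← Finset.sum_sub_distrib] at this
      rw [← this]
      simp only [Polynomial.eval_finsetSum, Polynomial.eval_monomial]
      exact Finset.sum_congr rfl fun k _ => by ring
    have := congrArg (Polynomial.eval s) hq
    simp only [Polynomial.eval_finsetSum, Polynomial.eval_monomial, Polynomial.eval_zero] at this
    simp only [Submodule.coe_sum, Submodule.coe_smul, Finsupp.finsetSum_apply,
        Finsupp.smul_apply, smul_eq_mul]
    rw [← sub_eq_zero, ← Finset.sum_sub_distrib, ← this]
    exact Finset.sum_congr rfl fun k _ => by ring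
  have hne' : ∀ s : ℂ, ∑ k ∈ Finset.range n, s ^ k • π (c k) ≠ 0 := by
    intro s h0
    refine hne s ?_
    rw [← hcoe, h0, Submodule.coe_zero]
  have hmap : ∀ s : ℂ, (Projectivization.mk ℂ (V := L) _ (hne' s)).submodule.map L.subtype =
      Submodule.span ℂ {∑ k ∈ Finset.range n, s ^ k • c k} := by
    intro s
    rw [Projectivization.submodule_mk, Submodule.map_span, Set.image_singleton,
      Submodule.subtype_apply, hcoe]
  refine ⟨_, mk_mem_of_curve hZ (fun k => π (c k)) hne' fun s hs => ?_, hmap 0⟩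
  obtain ⟨p, hpZ, hp⟩ := h s hs
  rw [← hmap s] at hp
  have := Submodule.map_injective_of_injective L.injective_subtype hp
  rwa [← Projectivization.submodule_injective this]

/-- Finitely many monomials occur in `E`. The bound is written `N + 1` so that the determinant of an
adjugate of size `N + 1` is an `N`-th power, without truncated subtraction. -/
theorem exists_support_bound (E : Submodule ℂ Fock) [hE : Module.Finite ℂ E] :
    ∃ (N : ℕ) (N' : ℤ), ∀ φ ∈ E, ∀ S, φ S ≠ 0 → IsTail (N + 1) S ∧ ∀ k, S.1 k ≤ N' := by
  classical
  obtain ⟨s, rfl⟩ := Module.Finite.iff_fg.1 hE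
  set T : Finset Maya := s.biUnion fun φ => φ.support with hT
  have hsupp : ∀ φ ∈ Submodule.span ℂ (s : Set Fock), ∀ S, φ S ≠ 0 → S ∈ T := by
    intro φ hφ S hS
    have h1 : Submodule.span ℂ (s : Set Fock) ≤ Finsupp.supported ℂ ℂ (T : Set Maya) := by
      rw [Submodule.span_le]
      intro ψ hψ
      rw [SetLike.mem_coe, Finsupp.mem_supported]
      exact_mod_cast Finset.subset_biUnion_of_mem (fun φ : Fock => φ.support) hψ
    exact_mod_cast (Finsupp.mem_supported ℂ _).1 (h1 hφ) (Finsupp.mem_support_iff.2 hS)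
  choose N hN using exists_isTail
  obtain ⟨N', hN'⟩ := (T.image fun S => S.1 0).bddAbove
  refine ⟨T.sup N, N', fun φ hφ S hS => ?_⟩
  have hST := hsupp φ hφ S hS
  refine ⟨(hN S).mono ((Finset.le_sup hST).trans (Nat.le_succ _)), fun k => ?_⟩
  exact (S.2.1.antitone (Nat.zero_le k)).trans
    (hN' (Finset.mem_coe.2 (Finset.mem_image_of_mem _ hST)))

variable {V : Type*} [AddCommGroup V] [Module ℂ V] (v : Module.Basis ℤ ℂ V)

theorem exists_frame_of_mem_pluckerLine {U : Submodule ℂ V} (hU : U ∈ sato v 0) {φ : Fock}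
    (hφ : φ ∈ pluckerLine v U) (hne : φ ≠ 0) {N : ℕ} {N' : ℤ}
    (hb : ∀ S, φ S ≠ 0 → IsTail N S ∧ ∀ k, S.1 k ≤ N') :
    ∃ (u : Fin N → V) (c : ℂ), (∀ a, u a ∈ lower v N') ∧ frameSpan v N u = U ∧
      φ = c • wedge v N u := by
  obtain ⟨M, u, rfl, hu⟩ := (sato_zero_iff v).1 hU
  rw [pluckerLine_frameSpan] at hφ
  obtain ⟨c, rfl⟩ := Submodule.mem_span_singleton.1 hφ
  have hc : c ≠ 0 := by rintro rfl; simp at hne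
  rw [← wedge_extend v (le_max_left M N) u] at hb hu
  have hb' := fun S (hS : wedge v (max M N) (fun a => extend v u a) S ≠ 0) =>
    hb S (by simpa [hc] using hS)
  obtain ⟨u', h1, h2, d, hd, h3⟩ := exists_bounded_frame v (le_max_right M N) hu
    (fun S hS => (hb' S hS).1) (fun S hS => (hb' S hS).2)
  refine ⟨u', c * d⁻¹, h1, ?_, ?_⟩
  · rw [h2, frameSpan_extend v (le_max_left M N)]
  · rw [h3, smul_smul, mul_assoc, inv_mul_cancel₀ hd, mul_one, wedge_extend v (le_max_left M N)]

theorem isHomPoly_wedge_coord {N : ℕ} {h : Fin N → L →ₗ[ℂ] V} (S : Maya) :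
    IsHomPoly N fun x : L => wedge v N (fun b => h b x) S := by
  by_cases hS : IsTail N S
  · simp only [wedge_apply_of_isTail v _ hS, Matrix.det_apply']
    refine IsHomPoly.sum fun σ => IsHomPoly.const_mul _ ?_
    have := IsHomPoly.prod (L := L) (s := (Finset.univ : Finset (Fin N)))
      (F := fun i x => rowMat v (fun b => h b x) (fun a => S.1 a) (σ i) i) fun i =>
      IsHomPoly.linear ((Finsupp.lapply (S.1 (σ i))).comp (v.repr.toLinearMap.comp (h i)))
        fun _ => rfl
    rwa [Finset.card_univ, Fintype.card_fin] at this
  · simp only [wedge_apply_of_not_isTail v _ hS]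
    exact IsHomPoly.zero N

theorem isHomPoly_bilin {N : ℕ} {M : ℤ} {S : Maya} (b : V →ₗ[ℂ] V →ₗ[ℂ] ℂ) (k l : ℕ) :
    ∃ d, IsHomPoly d fun x : L => b (extend v (fun i => hat v N M S i x) k)
      (extend v (fun i => hat v N M S i x) l) := by
  by_cases hk : k < N <;> by_cases hl : l < N <;> simp only [extend, hk, hl, dite_true, dite_false]
  · refine ⟨1 + 1, ?_⟩
    have : ∀ x : L, b (hat v N M S ⟨k, hk⟩ x) (hat v N M S ⟨l, hl⟩ x) =
        ∑ j ∈ Finset.Ioc (-(N : ℤ)) M,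
          rowFun (Function.update (fun a : Fin N => S.1 a) ⟨k, hk⟩ j) x *
            b (v j) (hat v N M S ⟨l, hl⟩ x) := by
      intro x
      conv_lhs => rw [hat]
      simp only [LinearMap.sum_apply, LinearMap.smulRight_apply, map_sum, map_smul,
        LinearMap.smul_apply, smul_eq_mul]
    simp only [this]
    refine IsHomPoly.sum fun j => IsHomPoly.mul ?_ ?_
    · exact IsHomPoly.linear ((rowFun _).comp L.subtype) fun _ => rfl
    · exact IsHomPoly.linear ((b (v j)).comp ((hat v N M S ⟨l, hl⟩).comp L.subtype)) fun _ => rfl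
  · exact ⟨1, IsHomPoly.linear ((b.flip (v _)).comp ((hat v N M S ⟨k, hk⟩).comp L.subtype))
      fun _ => rfl⟩
  · exact ⟨1, IsHomPoly.linear ((b (v _)).comp ((hat v N M S ⟨l, hl⟩).comp L.subtype))
      fun _ => rfl⟩
  · exact ⟨0, IsHomPoly.const _⟩

/-- The points of the Grassmannian on which some bilinear forms vanish form a closed set. -/
theorem isIndClosed_isotropic (bs : Set (V →ₗ[ℂ] V →ₗ[ℂ] ℂ)) :
    IsIndClosed {p : ℙ ℂ L | ∃ U ∈ sato v 0, (∀ b ∈ bs, ∀ x ∈ U, ∀ y ∈ U, b x y = 0) ∧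
      p.submodule.map L.subtype = pluckerLine v U} := by
  refine isIndClosed_of_forall_isHomPoly fun E hE => ?_
  obtain ⟨N, N', hb⟩ := exists_support_bound (E.map L.subtype)
  -- The first family expresses decomposability: the wedge of the vectors `hat` built from `x` at
  -- `S` equals `x(S)^N • x`. The second says that the forms vanish on the span of these vectors and
  -- the remaining `v_{-k}`.
  refine ⟨{F | ∃ S S', IsTail (N + 1) S ∧ F = fun x : L =>
      wedge v (N + 1) (fun i => hat v (N + 1) N' S i x) S' - (x : Fock) S ^ N * (x : Fock) S'} ∪
    {F | ∃ S, IsTail (N + 1) S ∧ ∃ b ∈ bs, ∃ k l, F = fun x : L =>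
      b (extend v (fun i => hat v (N + 1) N' S i x) k)
        (extend v (fun i => hat v (N + 1) N' S i x) l)}, ?_, fun p hp => ?_⟩
  · rintro F (⟨S, S', hS, rfl⟩ | ⟨S, hS, b, -, k, l, rfl⟩)
    · refine ⟨N + 1, (isHomPoly_wedge_coord v
        (h := fun i => (hat v (N + 1) N' S i).comp L.subtype) S').sub
        (IsHomPoly.mul (IsHomPoly.pow ?_ N) ?_)⟩
      · exact IsHomPoly.linear ((Finsupp.lapply S).comp L.subtype) fun _ => rfl
      · exact IsHomPoly.linear ((Finsupp.lapply S').comp L.subtype) fun _ => rfl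
    · exact isHomPoly_bilin v b k l
  have hrep := p.rep_nonzero
  have hsub : p.submodule.map L.subtype = Submodule.span ℂ {(p.rep : Fock)} := by
    rw [Projectivization.submodule_eq, Submodule.map_span, Set.image_singleton,
      Submodule.subtype_apply]
  rw [Set.mem_ofPred_eq, hsub]
  generalize p.rep = x at hp hrep
  have hx0 : (x : Fock) ≠ 0 := fun h => hrep (Subtype.ext h)
  have hbx := hb x (Submodule.mem_map_of_mem hp)
  constructor
  · rintro ⟨U, hU, hbs, hpl⟩
    obtain ⟨u, c, hu, rfl, hxu⟩ := exists_frame_of_mem_pluckerLine v hU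
      (hpl ▸ Submodule.mem_span_singleton_self _) hx0 hbx
    rintro F (⟨S, S', hS, rfl⟩ | ⟨S, hS, b, hbb, k, l, rfl⟩)
    · dsimp only
      -- With `D` the minor of `u` at `S`, both sides are `c^(N+1) D^N` times the coordinate of
      -- `wedge u` at `S'`.
      rw [hxu, wedge_comb v (hat_smul_wedge v hS hu c), sub_eq_zero, Matrix.det_smul,
        Matrix.det_adjugate, ← wedge_apply_of_isTail v u hS, Fintype.card_fin]
      simp only [Finsupp.smul_apply, smul_eq_mul, Nat.add_sub_cancel]
      ring
    · have hmem : ∀ k, extend v (fun i => hat v (N + 1) N' S i x) k ∈ frameSpan v (N + 1) u := by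
        intro k
        rcases lt_or_ge k (N + 1) with hk | hk
        · rw [extend, dif_pos hk, hxu]
          exact (mem_frameSpan_iff v).2 ⟨_, hat_smul_wedge v hS hu c ⟨k, hk⟩⟩
        · rw [extend_of_ge v _ hk]
          exact lower_le_frameSpan v u (basis_mem_lower v (by omega))
      exact hbs b hbb _ (hmem k) _ (hmem l)
  · intro hF
    obtain ⟨S, hS⟩ := Finsupp.ne_iff.1 hx0
    have hST := (hbx S hS).1
    -- For `S` in the support of `x`, the equations exhibit a nonzero multiple of `x` as a wedge.
    have hw : wedge v (N + 1) (fun i => hat v (N + 1) N' S i x) =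
        (x : Fock) S ^ N • (x : Fock) := by
      ext S'
      exact sub_eq_zero.1 (hF _ (Or.inl ⟨S, S', hST, rfl⟩))
    have hd : (x : Fock) S ^ N ≠ 0 := pow_ne_zero _ hS
    refine ⟨frameSpan v (N + 1) fun i => hat v (N + 1) N' S i x,
      (sato_zero_iff v).2 ⟨_, _, rfl, ?_⟩, ?_, ?_⟩
    · rw [hw]
      exact smul_ne_zero hd hx0
    · intro b hbb y hy z hz
      have hsp := span_range_eq v fun k hk =>
        extend_of_ge v (fun i => hat v (N + 1) N' S i (x : Fock)) (k := k) hk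
      simp only [extend_fin] at hsp
      rw [← hsp] at hy hz
      induction hy using Submodule.span_induction with
      | zero => simp
      | add y₁ y₂ _ _ h₁ h₂ => simp [h₁, h₂]
      | smul c y _ h => simp [h]
      | mem y hy =>
        obtain ⟨k, rfl⟩ := hy
        induction hz using Submodule.span_induction with
        | zero => simp
        | add y₁ y₂ _ _ h₁ h₂ => simp [h₁, h₂]
        | smul c y _ h => simp [h]
        | mem z hz =>
          obtain ⟨l, rfl⟩ := hz
          exact hF _ (Or.inr ⟨S, hST, b, hbb, k, l, rfl⟩)
    · rw [pluckerLine_frameSpan, hw, Submodule.span_singleton_smul_eq (isUnit_iff_ne_zero.2 hd)]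

theorem map_frameSpan {N : ℕ} {g : V →ₗ[ℂ] V} (hg : ∀ j, j ≤ -(N : ℤ) → g (v j) = v j)
    (u : Fin N → V) : (frameSpan v N u).map g = frameSpan v N fun a => g (u a) := by
  rw [frameSpan, frameSpan, Submodule.map_sup, Submodule.map_span, ← Set.range_comp]
  congr 1
  rw [lower, Submodule.map_span, Set.image_image]
  congr 1
  exact Set.image_congr fun j hj => hg j hj

theorem wedge_map_ne_zero {N : ℕ} {g h : V →ₗ[ℂ] V}
    (hh : ∀ j, j ≤ -(N : ℤ) → h (v j) = v j) (hhg : h ∘ₗ g = LinearMap.id) {u : Fin N → V}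
    (hu : wedge v N u ≠ 0) : wedge v N (fun a => g (u a)) ≠ 0 := by
  intro h0
  refine hu ?_
  have : gact v h (wedge v N fun a => g (u a)) = wedge v N u := by
    rw [gact_wedge v hh]
    congr 1
    funext a
    exact LinearMap.congr_fun hhg (u a)
  rw [← this, h0, map_zero]

theorem exists_frame_fixed {U : Submodule ℂ V} (hU : U ∈ sato v 0) (M : ℕ) :
    ∃ (N : ℕ) (u : Fin N → V), M ≤ N ∧ U = frameSpan v N u ∧ wedge v N u ≠ 0 := by
  obtain ⟨N, u, rfl, hu⟩ := (sato_zero_iff v).1 hU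
  refine ⟨max N M, fun a => extend v u a, le_max_right _ _,
    (frameSpan_extend v (le_max_left N M) u).symm, ?_⟩
  rwa [wedge_extend v (le_max_left N M)]

variable {y : V →ₗ[ℂ] V} {M : ℕ}

theorem id_sub_comp_id_add (hy : y ∘ₗ y = 0) (s : ℂ) :
    (LinearMap.id + (-s) • y) ∘ₗ (LinearMap.id + s • y) = LinearMap.id := by
  rw [LinearMap.add_comp, LinearMap.comp_add, LinearMap.comp_add, LinearMap.smul_comp,
    LinearMap.smul_comp, LinearMap.comp_smul, LinearMap.comp_smul, hy]
  simp

theorem wedge_shear_ne_zero (hy : y ∘ₗ y = 0) (hM : ∀ j, j ≤ -(M : ℤ) → y (v j) = 0) (s : ℂ)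
    {N : ℕ} (hMN : M ≤ N) {u : Fin N → V} (hu : wedge v N u ≠ 0) :
    wedge v N (fun a => (LinearMap.id + s • y : V →ₗ[ℂ] V) (u a)) ≠ 0 :=
  wedge_map_ne_zero v (h := LinearMap.id + (-s) • y)
    (fun j hj => by simp [hM j (by omega)]) (id_sub_comp_id_add hy s) hu

theorem map_shear_mem_sato {U : Submodule ℂ V} (hU : U ∈ sato v 0) (hy : y ∘ₗ y = 0)
    (hM : ∀ j, j ≤ -(M : ℤ) → y (v j) = 0) (s : ℂ) :
    U.map (LinearMap.id + s • y) ∈ sato v 0 := by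
  obtain ⟨N, u, hMN, rfl, hu⟩ := exists_frame_fixed v hU M
  rw [map_frameSpan v fun j hj => by simp [hM j (by omega)]]
  exact (sato_zero_iff v).2 ⟨N, _, rfl, wedge_shear_ne_zero v hy hM s hMN hu⟩

/-- If a closed set contains the images of `U` under `1 + s y` for all `s ≠ 0`, then it
contains `U`. -/
theorem exists_mem_of_shear {Z : Set (ℙ ℂ L)} (hZ : IsIndClosed Z) {U : Submodule ℂ V}
    (hU : U ∈ sato v 0) (hy : y ∘ₗ y = 0) (hM : ∀ j, j ≤ -(M : ℤ) → y (v j) = 0)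
    (h : ∀ s : ℂ, s ≠ 0 → ∃ p ∈ Z, p.submodule.map L.subtype =
      pluckerLine v (U.map (LinearMap.id + s • y))) :
    ∃ p ∈ Z, p.submodule.map L.subtype = pluckerLine v U := by
  obtain ⟨N, u, hMN, rfl, hu⟩ := exists_frame_fixed v hU M
  have hc := fun s => wedge_add_smul v u (fun a => y (u a)) s
  have hne := fun s => wedge_shear_ne_zero v hy hM s hMN hu
  have hmap : ∀ s : ℂ, pluckerLine v ((frameSpan v N u).map (LinearMap.id + s • y)) =
      Submodule.span ℂ {wedge v N fun a => u a + s • y (u a)} := fun s => by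
    rw [map_frameSpan v fun j hj => by simp [hM j (by omega)], pluckerLine_frameSpan]
    rfl
  simp only [hmap, hc] at h
  have := exists_mem_of_curve hZ _ (fun s => by rw [← hc]; exact hne s) h
  rw [← hc] at this
  simpa [pluckerLine_frameSpan] using this

end Fock

/-! ### The loop space: the operator `pr t`, the form, and Lagrangian points. -/

section Loop

variable {W : Type*} [AddCommGroup W]

/-- The part of `x` in the span of the `W ⊗ t^i`, `-K ≤ i < K`. -/
def cut (K : ℕ) (x : ℤ →₀ W) : ℤ →₀ W := x.filter fun i => -(K : ℤ) ≤ i ∧ i < K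

theorem cut_apply (K : ℕ) (x : ℤ →₀ W) (i : ℤ) :
    cut K x i = if -(K : ℤ) ≤ i ∧ i < K then x i else 0 := Finsupp.filter_apply ..

variable [Module ℂ W]

/-! ### The operator `pr t` -/

/-- The operator `pr t` on `W ⊗ ℂ[t, t⁻¹]`. -/
def tau : Module.End ℂ (ℤ →₀ W) := pr ∘ₗ mulT

theorem tau_apply (x : ℤ →₀ W) (i : ℤ) : tau x i = if i = 0 then 0 else x (i - 1) := by
  have h : mulT x i = x (i - 1) := by
    have := Finsupp.mapDomain_apply (f := fun j : ℤ => j + 1) (add_left_injective 1) x (i - 1)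
    rw [sub_add_cancel] at this
    exact this
  simp only [tau, pr, LinearMap.comp_apply, LinearMap.sub_apply, LinearMap.id_apply,
    Finsupp.sub_apply, Finsupp.lsingle_apply, Finsupp.lapply_apply]
  split_ifs with hi
  · subst hi; simp
  · rw [Finsupp.single_eq_of_ne hi, sub_zero, h]

theorem tau_pow_apply (m : ℕ) (x : ℤ →₀ W) (i : ℤ) :
    (tau ^ m) x i = if 0 ≤ i ∧ i < m then 0 else x (i - m) := by
  induction m generalizing i with
  | zero => simp
  | succ m ih =>
    rw [pow_succ', Module.End.mul_apply, tau_apply, ih]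
    push_cast
    split_ifs <;> first | rfl | omega | (congr 1; omega)

theorem tau_single (i : ℤ) (a : W) :
    tau (Finsupp.single i a) = if i = -1 then 0 else Finsupp.single (i + 1) a := by
  ext j
  rw [tau_apply]
  split_ifs with h1 h2 h2
  · rfl
  · subst h1; rw [Finsupp.single_eq_of_ne (by omega)]
  · rw [Finsupp.single_eq_of_ne (by omega)]; rfl
  · simp only [Finsupp.single_apply]
    congr 1
    simp only [eq_iff_iff]
    omega

theorem tau_pow_single {i : ℤ} (hi : 0 ≤ i) (m : ℕ) (a : W) :
    (tau ^ m) (Finsupp.single i a) = Finsupp.single (i + m) a := by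
  induction m with
  | zero => simp
  | succ m ih =>
    rw [pow_succ', Module.End.mul_apply, ih, tau_single, if_neg (by omega)]
    push_cast
    rw [add_assoc]

/-! ### The form -/

/-- The form `loopForm` as a bilinear map. -/
def lform (B : LinearMap.BilinForm ℂ W) : (ℤ →₀ W) →ₗ[ℂ] (ℤ →₀ W) →ₗ[ℂ] ℂ :=
  Finsupp.lsum ℂ fun i : ℤ => LinearMap.compl₂ B (Finsupp.lapply (-1 - i))

variable (B : LinearMap.BilinForm ℂ W)

theorem lform_eq_sum (x y : ℤ →₀ W) : lform B x y = x.sum fun i a => B a (y (-1 - i)) := by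
  simp [lform, Finsupp.sum, LinearMap.sum_apply]

theorem lform_single_left (i : ℤ) (a : W) (y : ℤ →₀ W) :
    lform B (Finsupp.single i a) y = B a (y (-1 - i)) := by
  rw [lform_eq_sum, Finsupp.sum_single_index (by simp)]

theorem loopForm_eq (x y : ℤ →₀ W) : loopForm B x y = lform B x y := by
  rw [lform_eq_sum, loopForm]
  refine Finsupp.sum_congr fun i _ => ?_
  have : ∀ j, (i + j = -1) ↔ (-1 - i = j) := fun j => by omega
  simp only [this, Finsupp.sum, Finset.sum_ite_eq]
  split_ifs with h
  · rfl
  · rw [Finsupp.notMem_support_iff.1 h, map_zero]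

theorem lform_eq_zero {x y : ℤ →₀ W} (h : ∀ i, x i = 0 ∨ y (-1 - i) = 0) : lform B x y = 0 := by
  rw [lform_eq_sum]
  refine Finset.sum_eq_zero fun i _ => ?_
  rcases h i with h | h <;> simp [h]

/-- The form pairs `t^i` with `t^(-1-i)`. Multiplication by `t` is self-adjoint, and the deleted
step from `t⁻¹` to `1` is its own adjoint. -/
theorem lform_tau (x y : ℤ →₀ W) : lform B (tau x) y = lform B x (tau y) := by
  induction x using Finsupp.induction_linear with
  | zero => simp
  | add x₁ x₂ h₁ h₂ => simp [h₁, h₂]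
  | single i a =>
    rw [lform_single_left, tau_single, tau_apply]
    split_ifs with h1 h2 h2
    · simp
    · omega
    · omega
    · rw [lform_single_left]
      congr 2
      omega

theorem lform_tau_pow (m : ℕ) (x y : ℤ →₀ W) :
    lform B ((tau ^ m) x) y = lform B x ((tau ^ m) y) := by
  induction m generalizing x with
  | zero => rfl
  | succ m ih => rw [pow_succ, Module.End.mul_apply, ih, lform_tau, ← Module.End.mul_apply,
      ← pow_succ', ← pow_succ]

variable {B}

theorem lform_neg (hB : B.IsAlt) (x y : ℤ →₀ W) : lform B y x = -lform B x y := by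
  induction x using Finsupp.induction_linear with
  | zero => simp
  | add x₁ x₂ h₁ h₂ => simp only [map_add, LinearMap.add_apply, h₁, h₂]; ring
  | single i a =>
    induction y using Finsupp.induction_linear with
    | zero => simp
    | add x₁ x₂ h₁ h₂ => simp only [map_add, LinearMap.add_apply, h₁, h₂]; ring
    | single j b =>
      rw [lform_single_left, lform_single_left]
      simp only [Finsupp.single_apply]
      by_cases h : i = -1 - j
      · rw [if_pos h, if_pos (by omega), hB.neg_eq]
      · rw [if_neg h, if_neg (by omega)]; simp

/-- The value depends only on `i + j`, so it is symmetric under exchanging the arguments, and it is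
also antisymmetric. -/
theorem lform_tau_pow_self (hB : B.IsAlt) (i j : ℕ) (f : ℤ →₀ W) :
    lform B ((tau ^ i) f) ((tau ^ j) f) = 0 := by
  have h : ∀ k l : ℕ, lform B ((tau ^ k) f) ((tau ^ l) f) = lform B f ((tau ^ (k + l)) f) := by
    intro k l
    rw [lform_tau_pow, ← Module.End.mul_apply, ← pow_add]
  refine CharZero.eq_neg_self_iff.1 ?_
  rw [← lform_neg hB, h, h, add_comm]

/-! ### The filtration by powers of `t` -/

/-- The subspace `t^K W[t]`. -/
def hi (K : ℤ) : Submodule ℂ (ℤ →₀ W) where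
  carrier := {x | ∀ i, i < K → x i = 0}
  add_mem' hx hy i hi := by simp [hx i hi, hy i hi]
  zero_mem' i _ := rfl
  smul_mem' c x hx i hi := by simp [hx i hi]

/-- The subspace `t⁻¹ W[t⁻¹]`. -/
def lo : Submodule ℂ (ℤ →₀ W) where
  carrier := {x | ∀ i, 0 ≤ i → x i = 0}
  add_mem' hx hy i hi := by simp [hx i hi, hy i hi]
  zero_mem' i _ := rfl
  smul_mem' c x hx i hi := by simp [hx i hi]

/-- The span of the `W ⊗ t^i`, `-K ≤ i < K`. -/
def window (K : ℕ) : Submodule ℂ (ℤ →₀ W) where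
  carrier := {x | ∀ i, i < -(K : ℤ) ∨ (K : ℤ) ≤ i → x i = 0}
  add_mem' hx hy i hi := by simp [hx i hi, hy i hi]
  zero_mem' i _ := rfl
  smul_mem' c x hx i hi := by simp [hx i hi]

theorem mem_hi {K : ℤ} {x : ℤ →₀ W} : x ∈ hi K ↔ ∀ i, i < K → x i = 0 := Iff.rfl

theorem single_mem_hi {K i : ℤ} (h : K ≤ i) (a : W) : Finsupp.single i a ∈ hi K :=
  fun j hj => Finsupp.single_eq_of_ne (by omega)

theorem hi_anti {K K' : ℤ} (h : K ≤ K') : hi (W := W) K' ≤ hi K :=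
  fun _ hx i hi => hx i (by omega)

theorem window_le_hi (K : ℕ) : window (W := W) K ≤ hi (-(K : ℤ)) :=
  fun _ hx i hi => hx i (Or.inl hi)

theorem hi_le {K : ℤ} {Y : Submodule ℂ (ℤ →₀ W)}
    (h : ∀ i a, K ≤ i → Finsupp.single i a ∈ Y) : hi K ≤ Y := by
  intro x hx
  rw [← x.sum_single]
  refine Y.sum_mem fun i hi => h i _ ?_
  by_contra hcon
  exact Finsupp.mem_support_iff.1 hi (hx i (by omega))

theorem tau_mem_hi {K : ℤ} {x : ℤ →₀ W} (hx : x ∈ hi K) : tau x ∈ hi K := by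
  intro i hi
  rw [tau_apply, hx (i - 1) (by omega), ite_self]

theorem tau_pow_mem {Y : Submodule ℂ (ℤ →₀ W)} (h : ∀ x ∈ Y, tau x ∈ Y) (m : ℕ)
    {x : ℤ →₀ W} (hx : x ∈ Y) : (tau ^ m) x ∈ Y := by
  induction m with
  | zero => exact hx
  | succ m ih => rw [pow_succ', Module.End.mul_apply]; exact h _ ih

theorem tau_mem_lo {x : ℤ →₀ W} (hx : x ∈ lo) : tau x ∈ lo := by
  intro i hi
  rw [tau_apply]
  split_ifs with h
  · rfl
  · exact hx _ (by omega)

theorem lform_lo (B : LinearMap.BilinForm ℂ W) {x y : ℤ →₀ W} (hx : x ∈ lo) (hy : y ∈ lo) :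
    lform B x y = 0 :=
  lform_eq_zero B fun i => by
    rcases le_or_gt 0 i with h | h
    · exact Or.inl (hx i h)
    · exact Or.inr (hy _ (by omega))

theorem lform_hi (B : LinearMap.BilinForm ℂ W) {K K' : ℤ} (h : 0 ≤ K + K') {x y : ℤ →₀ W}
    (hx : x ∈ hi K) (hy : y ∈ hi K') : lform B x y = 0 :=
  lform_eq_zero B fun i => by
    rcases lt_or_ge i K with h' | h'
    · exact Or.inl (hx i h')
    · exact Or.inr (hy _ (by omega))

theorem cut_mem_window (K : ℕ) (x : ℤ →₀ W) : cut K x ∈ window K := by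
  intro i hi
  rw [cut_apply, if_neg (by omega)]

theorem sub_cut_mem_hi {K : ℕ} {x : ℤ →₀ W} (hx : x ∈ hi (-(K : ℤ))) :
    x - cut K x ∈ hi (K : ℤ) := by
  intro i hi
  rw [Finsupp.sub_apply, cut_apply]
  split_ifs with h
  · exact sub_self _
  · rw [hx i (by omega), sub_zero]

theorem lform_sub_cut (B : LinearMap.BilinForm ℂ W) {K : ℕ} {f : ℤ →₀ W} (hf : f ∈ window K)
    (x : ℤ →₀ W) : lform B f (x - cut K x) = 0 :=
  lform_eq_zero B fun i => by
    by_cases h : -(K : ℤ) ≤ i ∧ i < K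
    · right
      rw [Finsupp.sub_apply, cut_apply, if_pos (by omega), sub_self]
    · exact Or.inl (hf i (by omega))

/-! ### Duality -/

/-- Separation of the form `B`. -/
def Separates (B : LinearMap.BilinForm ℂ W) : Prop := ∀ b, (∀ a, B a b = 0) → b = 0

theorem Separates.eq_zero (hnd : Separates B) {x : ℤ →₀ W} {i : ℤ}
    (h : ∀ a, lform B (Finsupp.single (-1 - i) a) x = 0) : x i = 0 := by
  refine hnd _ fun a => ?_
  have := h a
  rw [lform_single_left] at this
  rwa [show -1 - (-1 - i) = i by ring] at this

theorem window_eq_zero (hnd : Separates B) {K : ℕ} {x : ℤ →₀ W} (hx : x ∈ window K)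
    (h : ∀ y ∈ window K, lform B y x = 0) : x = 0 := by
  ext i
  by_cases hi : i < -(K : ℤ) ∨ (K : ℤ) ≤ i
  · exact hx i hi
  · refine hnd.eq_zero fun a => h _ fun j hj => ?_
    rw [Finsupp.single_eq_of_ne (by omega)]

/-- The restriction of the form to the span of the `W ⊗ t^i`, `-K ≤ i < K`. -/
def windowForm (B : LinearMap.BilinForm ℂ W) (K : ℕ) : LinearMap.BilinForm ℂ (window (W := W) K) :=
  (lform B).domRestrict₁₂ (window K) (window K)

theorem windowForm_nondegenerate (hB : B.IsAlt) (hnd : Separates B) (K : ℕ) :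
    (windowForm B K).Nondegenerate := by
  refine ⟨fun x hx => ?_, fun x hx => ?_⟩
  · refine Subtype.ext (window_eq_zero hnd x.2 fun y hy => ?_)
    rw [lform_neg hB, neg_eq_zero]
    exact hx ⟨y, hy⟩
  · exact Subtype.ext (window_eq_zero hnd x.2 fun y hy => hx ⟨y, hy⟩)

section Finite

variable {d : ℕ} [NeZero d] (w : Module.Basis (Fin d) ℂ W)

theorem repr_loopBasis (x : ℤ →₀ W) (i : ℤ) (j : Fin d) :
    (loopBasis w).repr x (foldEquiv d ⟨i, j⟩) = w.repr (x i) j := by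
  rw [loopBasis, Module.Basis.repr_reindex_apply, Equiv.symm_apply_apply]
  rfl

theorem lower_loopBasis (K : ℤ) : lower (loopBasis w) (-(d * K)) = hi K := by
  have hd : (0 : ℤ) < d := by exact_mod_cast Nat.pos_of_ne_zero (NeZero.ne d)
  have hlt : ∀ i (j : Fin d), -(d * K) < foldEquiv d ⟨i, j⟩ ↔ i < K := by
    intro i j
    have hj : ((j : ℕ) : ℤ) < d := by exact_mod_cast j.2
    have hj0 : (0 : ℤ) ≤ ((j : ℕ) : ℤ) := by positivity
    simp only [foldEquiv, Equiv.coe_fn_mk]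
    constructor
    · intro h
      by_contra hi
      nlinarith
    · intro h
      nlinarith
  ext x
  rw [mem_lower_iff, mem_hi]
  constructor
  · intro h i hi
    refine w.ext_elem fun j => ?_
    rw [← repr_loopBasis, h _ ((hlt i j).2 hi)]
    simp
  · intro h m hm
    obtain ⟨⟨i, j⟩, rfl⟩ := (foldEquiv d).surjective m
    rw [repr_loopBasis, h i ((hlt i j).1 hm)]
    simp

theorem le_mul_of_neZero (N : ℕ) : N ≤ d * N :=
  Nat.le_mul_of_pos_left _ (Nat.pos_of_ne_zero (NeZero.ne d))

theorem finite_window (w : Module.Basis (Fin d) ℂ W) (K : ℕ) :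
    Module.Finite ℂ (window (W := W) K) ∧
    Module.finrank ℂ (window (W := W) K) ≤ 2 * (d * K) := by
  classical
  set T : Finset (ℤ →₀ W) := (Finset.Ioc (-((d * K : ℕ) : ℤ)) (d * K : ℕ)).image (loopBasis w)
    with hT
  have hle : window (W := W) K ≤ Submodule.span ℂ (T : Set (ℤ →₀ W)) := by
    intro x hx
    rw [hT, Finset.coe_image, Module.Basis.mem_span_image]
    intro m hm
    have h1 : x ∈ lower (loopBasis w) (d * K : ℕ) := by
      have := lower_loopBasis w (-(K : ℤ))
      rw [mul_neg, neg_neg] at this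
      push_cast
      rw [this]
      exact window_le_hi K hx
    have hm0 := Finsupp.mem_support_iff.1 hm
    simp only [Finset.coe_Ioc, Set.mem_Ioc]
    refine ⟨?_, ?_⟩
    · by_contra hcon
      obtain ⟨⟨i, j⟩, rfl⟩ := (foldEquiv d).surjective m
      refine hm0 ?_
      rw [repr_loopBasis, hx i (Or.inr ?_)]
      · simp
      · by_contra hik
        have hmem : Finsupp.single i (w j) ∉ hi (W := W) K := fun h => by
          have := h i (by omega)
          rw [Finsupp.single_eq_same] at this
          exact w.ne_zero j this
        rw [← lower_loopBasis w] at hmem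
        refine hmem ?_
        have h2 : Finsupp.single i (w j) = loopBasis w (foldEquiv d ⟨i, j⟩) := by
          simp [loopBasis]
        rw [h2]
        refine basis_mem_lower _ ?_
        push_cast at hcon
        omega
    · by_contra hcon
      exact hm0 ((mem_lower_iff _).1 h1 m (by omega))
  have hfin : Module.Finite ℂ (Submodule.span ℂ (T : Set (ℤ →₀ W))) :=
    FiniteDimensional.span_finset ℂ T
  refine ⟨Submodule.finiteDimensional_of_le hle, (Submodule.finrank_mono hle).trans ?_⟩
  refine (finrank_span_finset_le_card T).trans (Finset.card_image_le.trans ?_)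
  rw [Int.card_Ioc]
  omega

/-- Lengthening the frame to a multiple of `d` makes its tail exactly `t^K W[t]`. -/
theorem exists_hi_le {U : Submodule ℂ (ℤ →₀ W)} (hU : U ∈ sato (loopBasis w) 0) (M : ℕ) :
    ∃ (K : ℕ) (u : Fin (d * K) → (ℤ →₀ W)), M ≤ K ∧ U = frameSpan (loopBasis w) (d * K) u ∧
      wedge (loopBasis w) (d * K) u ≠ 0 ∧ hi (K : ℤ) ≤ U := by
  obtain ⟨N, u, hMN, rfl, hu⟩ := exists_frame_fixed (loopBasis w) hU M
  have hN := le_mul_of_neZero (d := d) N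
  refine ⟨N, fun a => extend (loopBasis w) u a, hMN,
    (frameSpan_extend (loopBasis w) hN u).symm, ?_, ?_⟩
  · rwa [wedge_extend (loopBasis w) hN]
  · rw [← frameSpan_extend (loopBasis w) hN, ← lower_loopBasis w]
    have := lower_le_frameSpan (loopBasis w) (fun a : Fin (d * N) => extend (loopBasis w) u a)
    push_cast at this
    exact this

theorem le_hi_of_isotropic (hnd : Separates B) {K : ℕ} {U : Submodule ℂ (ℤ →₀ W)}
    (hK : hi (K : ℤ) ≤ U) {x : ℤ →₀ W} (hx : ∀ y ∈ U, lform B y x = 0) : x ∈ hi (-(K : ℤ)) :=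
  fun i hi => hnd.eq_zero fun a => hx _ (hK (single_mem_hi (by omega) a))

theorem le_finrank_of_independent {M : Type*} [AddCommGroup M] [Module ℂ M] [Module.Finite ℂ M]
    {n : ℕ} {Y : Submodule ℂ M} {b : Fin n → M} (hb : ∀ a, b a ∈ Y)
    (h : ∀ c : Fin n → ℂ, ∑ a, c a • b a = 0 → c = 0) : n ≤ Module.finrank ℂ Y := by
  let f : (Fin n → ℂ) →ₗ[ℂ] Y := (Fintype.linearCombination ℂ b).codRestrict Y fun c => by
    rw [Fintype.linearCombination_apply]
    exact Y.sum_mem fun a _ => Y.smul_mem _ (hb a)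
  have hf : Function.Injective f := by
    rw [injective_iff_map_eq_zero]
    intro c hc
    refine h c ?_
    rw [← Fintype.linearCombination_apply]
    exact congrArg Subtype.val hc
  simpa using LinearMap.finrank_le_finrank_of_injective hf

/-- An isotropic point of the Grassmannian is its own orthogonal complement. -/
theorem mem_of_forall_lform_eq_zero (hB : B.IsAlt) (hnd : Separates B)
    {U : Submodule ℂ (ℤ →₀ W)} (hU : U ∈ sato (loopBasis w) 0)
    (hiso : ∀ x ∈ U, ∀ y ∈ U, lform B x y = 0) {x : ℤ →₀ W} (hx : ∀ y ∈ U, lform B y x = 0) :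
    x ∈ U := by
  obtain ⟨K, u, -, hUu, hw, hK⟩ := exists_hi_le w hU 0
  have hUK : ∀ y ∈ U, y ∈ hi (-(K : ℤ)) := fun y hy =>
    le_hi_of_isotropic hnd hK fun z hz => hiso z hz y hy
  have hcut : ∀ y ∈ U, cut K y ∈ U := fun y hy => by
    have := U.sub_mem hy (hK (sub_cut_mem_hi (hUK y hy)))
    rwa [sub_sub_cancel] at this
  obtain ⟨hfin, hrank⟩ := finite_window w K
  set UF : Submodule ℂ (window (W := W) K) := U.comap (window K).subtype with hUF
  have huU : ∀ a, u a ∈ U := fun a => hUu ▸ mem_frameSpan _ u a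
  have hlow : lower (loopBasis w) (-((d * K : ℕ) : ℤ)) = hi (K : ℤ) := by
    push_cast
    exact lower_loopBasis w _
  -- Cutting changes the frame vectors only by elements of `t^K W[t]`, so they stay independent.
  have hUFrank : d * K ≤ Module.finrank ℂ UF := by
    refine le_finrank_of_independent (b := fun a => ⟨cut K (u a), cut_mem_window K _⟩)
      (fun a => hcut _ (huU a)) fun c hc => ?_
    refine independent_of_wedge_ne_zero (loopBasis w) hw (c := c) ?_
    have h0 : ∑ a, c a • cut K (u a) = 0 := by
      have := congrArg (fun z : window (W := W) K => (z : ℤ →₀ W)) hc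
      simpa using this
    rw [hlow, ← sub_zero (∑ a, c a • u a), ← h0, ← Finset.sum_sub_distrib]
    refine Submodule.sum_mem _ fun a _ => ?_
    rw [← smul_sub]
    exact Submodule.smul_mem _ _ (sub_cut_mem_hi (hUK _ (huU a)))
  have horth : UF ≤ (windowForm B K).orthogonal UF := by
    intro y hy
    rw [LinearMap.BilinForm.mem_orthogonal_iff]
    exact fun z hz => hiso _ hz _ hy
  -- The window has dimension at most `2 d K` and a nondegenerate form, so an isotropic subspace of
  -- dimension at least `d K` is its own orthogonal complement.
  have heq : UF = (windowForm B K).orthogonal UF := by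
    refine Submodule.eq_of_le_of_finrank_le horth ?_
    rw [LinearMap.BilinForm.finrank_orthogonal (windowForm_nondegenerate hB hnd K)]
    omega
  have hxK := le_hi_of_isotropic hnd hK hx
  have hxF : (⟨cut K x, cut_mem_window K x⟩ : window (W := W) K) ∈ UF := by
    rw [heq, LinearMap.BilinForm.mem_orthogonal_iff]
    intro y hy
    change lform B y (cut K x) = 0
    have h1 := lform_sub_cut B y.2 x
    rw [map_sub, show lform B y x = 0 from hx _ hy, zero_sub, neg_eq_zero] at h1
    exact h1
  have := U.add_mem (show cut K x ∈ U from hxF) (hK (sub_cut_mem_hi hxK))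
  rwa [add_sub_cancel] at this

/-- A vector outside of `Y ⊇ t^K W[t]` is detected by the form. -/
theorem exists_lform_ne_zero (w : Module.Basis (Fin d) ℂ W) (hB : B.IsAlt) (hnd : Separates B)
    (K : ℕ)
    {Y : Submodule ℂ (ℤ →₀ W)} (hY : hi (K : ℤ) ≤ Y) {p : ℤ →₀ W} (hp : p ∉ Y)
    (hpK : p ∈ hi (-(K : ℤ))) :
    ∃ f ∈ window K, lform B f p ≠ 0 ∧ ∀ x, cut K x ∈ Y → lform B f x = 0 := by
  obtain ⟨ℓ, hℓp, hℓY⟩ := Submodule.exists_le_ker_of_notMem hp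
  have := (finite_window w K).1
  -- `f` represents, on the window, a functional `ℓ` that vanishes on `Y` but not at `p`.
  set f := ((windowForm B K).toDual (windowForm_nondegenerate hB hnd K)).symm
    (ℓ ∘ₗ (window K).subtype) with hf
  have hfx : ∀ x, lform B f x = ℓ (cut K x) := by
    intro x
    have h1 := lform_sub_cut B f.2 x
    rw [map_sub, sub_eq_zero] at h1
    rw [h1]
    have h2 := LinearMap.BilinForm.toDual_def (windowForm_nondegenerate hB hnd K) (m := f)
      (n := ⟨cut K x, cut_mem_window K x⟩)
    rw [hf, LinearEquiv.apply_symm_apply] at h2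
    exact h2.symm
  refine ⟨f, f.2, ?_, fun x hx => ?_⟩
  · rw [hfx]
    have : ℓ (p - cut K p) = 0 := hℓY (hY (sub_cut_mem_hi hpK))
    rw [map_sub, sub_eq_zero] at this
    rwa [← this]
  · rw [hfx]
    exact hℓY hx

end Finite

end Loop

/-! ### The shear that moves an admissible subspace away from `t⁻¹W[t⁻¹]`. -/

section Shear

variable {W : Type*} [AddCommGroup W] [Module ℂ W] {B : LinearMap.BilinForm ℂ W}

variable (B) in
/-- The nilpotent operator `x ↦ ∑_{i + j = m} ⟨f, (pr t)^i x⟩ (pr t)^j f`. -/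
def shear (f : ℤ →₀ W) (m : ℕ) : Module.End ℂ (ℤ →₀ W) :=
  ∑ i ∈ Finset.range (m + 1), ((lform B f) ∘ₗ tau ^ i).smulRight ((tau ^ (m - i)) f)

theorem shear_apply (f : ℤ →₀ W) (m : ℕ) (x : ℤ →₀ W) : shear B f m x =
    ∑ i ∈ Finset.range (m + 1), lform B f ((tau ^ i) x) • (tau ^ (m - i)) f := by
  simp [shear, LinearMap.sum_apply]

theorem shear_tau_pow (hB : B.IsAlt) (f : ℤ →₀ W) (m j : ℕ) :
    shear B f m ((tau ^ j) f) = 0 := by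
  rw [shear_apply]
  refine Finset.sum_eq_zero fun i _ => ?_
  rw [← Module.End.mul_apply, ← pow_add]
  have := lform_tau_pow_self hB 0 (i + j) f
  rw [pow_zero, Module.End.one_apply] at this
  rw [this, zero_smul]

theorem shear_comp_shear (hB : B.IsAlt) (f : ℤ →₀ W) (m : ℕ) :
    shear B f m ∘ₗ shear B f m = 0 := by
  refine LinearMap.ext fun x => ?_
  rw [LinearMap.comp_apply, shear_apply f m x, map_sum]
  exact Finset.sum_eq_zero fun i _ => by rw [map_smul, shear_tau_pow hB, smul_zero]

/-- By self-adjointness of `tau`, exchanging `x` and `y` amounts to reversing the sum, `i ↦ m - i`.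
Thus the shear is skew-adjoint. -/
theorem lform_shear_add (hB : B.IsAlt) (f : ℤ →₀ W) (m : ℕ) (x y : ℤ →₀ W) :
    lform B (shear B f m x) y + lform B x (shear B f m y) = 0 := by
  rw [lform_neg hB (shear B f m y) x]
  simp only [shear_apply, map_sum, LinearMap.sum_apply, map_smul, LinearMap.smul_apply,
    smul_eq_mul, lform_tau_pow]
  rw [← Finset.sum_range_reflect (fun i => lform B f ((tau ^ i) y) *
    lform B f ((tau ^ (m - i)) x)), ← sub_eq_add_neg, sub_eq_zero]
  refine Finset.sum_congr rfl fun i hi => ?_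
  have := Finset.mem_range.1 hi
  rw [show m + 1 - 1 - i = m - i by omega, show m - (m - i) = i by omega, mul_comm]

theorem lform_shear_shear (hB : B.IsAlt) (f : ℤ →₀ W) (m : ℕ) (x y : ℤ →₀ W) :
    lform B (shear B f m x) (shear B f m y) = 0 := by
  have := lform_shear_add hB f m x (shear B f m y)
  rwa [← LinearMap.comp_apply (shear B f m), shear_comp_shear hB, LinearMap.zero_apply, map_zero,
    add_zero] at this

theorem lform_add_smul_shear (hB : B.IsAlt) (f : ℤ →₀ W) (m : ℕ) (s : ℂ) (x y : ℤ →₀ W) :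
    lform B (x + s • shear B f m x) (y + s • shear B f m y) = lform B x y := by
  have h1 := lform_shear_add hB f m x y
  have h2 := lform_shear_shear hB f m x y
  simp only [map_add, map_smul, LinearMap.add_apply, LinearMap.smul_apply, smul_eq_mul, h2]
  linear_combination s * h1

/-- Both `tau (shear x)` and `shear (tau x)` are partial sums of the terms `⟨f, τ^i x⟩ τ^(m+1-i) f`
for `0 ≤ i ≤ m + 1`: one omits `i = m + 1`, the other omits `i = 0`. -/
theorem tau_shear (f : ℤ →₀ W) (m : ℕ) (x : ℤ →₀ W) :
    tau (shear B f m x) = shear B f m (tau x) + lform B f x • (tau ^ (m + 1)) f -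
      lform B f ((tau ^ (m + 1)) x) • f := by
  have h1 : tau (shear B f m x) = ∑ i ∈ Finset.range (m + 1),
      lform B f ((tau ^ i) x) • (tau ^ (m + 1 - i)) f := by
    rw [shear_apply, map_sum]
    refine Finset.sum_congr rfl fun i hi => ?_
    have := Finset.mem_range.1 hi
    rw [map_smul, ← Module.End.mul_apply, ← pow_succ', show m - i + 1 = m + 1 - i by omega]
  have h2 : shear B f m (tau x) = ∑ i ∈ Finset.range (m + 1),
      lform B f ((tau ^ (i + 1)) x) • (tau ^ (m + 1 - (i + 1))) f := by
    rw [shear_apply]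
    refine Finset.sum_congr rfl fun i _ => ?_
    rw [← Module.End.mul_apply, ← pow_succ, Nat.add_sub_add_right]
  have h3 := Finset.sum_range_succ (fun i => lform B f ((tau ^ i) x) • (tau ^ (m + 1 - i)) f)
    (m + 1)
  have h4 := Finset.sum_range_succ' (fun i => lform B f ((tau ^ i) x) • (tau ^ (m + 1 - i)) f)
    (m + 1)
  rw [← h1] at h3
  rw [← h2, h3, Nat.sub_self, pow_zero, Module.End.one_apply, Module.End.one_apply,
    Nat.sub_zero] at h4
  rw [← h4]
  abel

/-- The span of `W ⊗ t⁻¹`. -/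
def residue : Submodule ℂ (ℤ →₀ W) where
  carrier := {x | ∀ i, i ≠ -1 → x i = 0}
  add_mem' hx hy i hi := by simp [hx i hi, hy i hi]
  zero_mem' i _ := rfl
  smul_mem' c x hx i hi := by simp [hx i hi]

theorem residue_le_lo : residue (W := W) ≤ lo := fun _ hx i hi => hx i (by omega)

theorem tau_residue {x : ℤ →₀ W} (hx : x ∈ residue) : tau x = 0 := by
  ext i
  rw [tau_apply]
  split_ifs with h
  · rfl
  · exact hx _ (by omega)

theorem tau_pow_residue {x : ℤ →₀ W} (hx : x ∈ residue) {m : ℕ} (hm : m ≠ 0) :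
    (tau ^ m) x = 0 := by
  obtain ⟨m, rfl⟩ := Nat.exists_eq_succ_of_ne_zero hm
  rw [pow_succ, Module.End.mul_apply, tau_residue hx, map_zero]

/-- A subspace is isotropic and stable under `pr t`. -/
structure IsAdmissible (B : LinearMap.BilinForm ℂ W) (U : Submodule ℂ (ℤ →₀ W)) : Prop where
  isotropic : ∀ x ∈ U, ∀ y ∈ U, lform B x y = 0
  tau_mem : ∀ x ∈ U, tau x ∈ U

/-- `tau` is locally nilpotent on `t⁻¹W[t⁻¹]` with kernel `W ⊗ t⁻¹`; the last nonzero iterate of `x`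
is the required vector. -/
theorem exists_mem_residue {U : Submodule ℂ (ℤ →₀ W)} (hU : IsAdmissible B U) {x : ℤ →₀ W}
    (hxU : x ∈ U) (hx : x ∈ lo) (hx0 : x ≠ 0) : ∃ p ∈ U, p ∈ residue ∧ p ≠ 0 := by
  classical
  have hex : ∃ m, (tau ^ m) x = 0 := by
    obtain ⟨K, hK⟩ := x.support.bddBelow
    refine ⟨(-K).toNat + 1, ?_⟩
    ext i
    rw [tau_pow_apply]
    split_ifs with h
    · rfl
    · by_contra hne
      have h1 := hK (Finsupp.mem_support_iff.2 hne)
      rcases lt_or_ge i 0 with h2 | h2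
      · omega
      · exact hne (hx _ (by omega))
  have hm0 : Nat.find hex ≠ 0 := by
    intro h
    have := Nat.find_spec hex
    rw [h] at this
    exact hx0 this
  obtain ⟨m, hm⟩ := Nat.exists_eq_succ_of_ne_zero hm0
  have hlo : (tau ^ m) x ∈ lo := tau_pow_mem (fun y hy => tau_mem_lo hy) m hx
  refine ⟨(tau ^ m) x, tau_pow_mem hU.tau_mem m hxU, fun i hi => ?_,
    Nat.find_min hex (by omega)⟩
  rcases lt_or_ge i 0 with h | h
  · have h1 := Nat.find_spec hex
    rw [hm, pow_succ', Module.End.mul_apply] at h1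
    have h2 := DFunLike.congr_fun h1 (i + 1)
    rwa [tau_apply, if_neg (by omega), add_sub_cancel_right] at h2
  · exact hlo i h

variable {d : ℕ} [NeZero d] (w : Module.Basis (Fin d) ℂ W)

/-- An admissible point of the Grassmannian that meets `t⁻¹ W[t⁻¹]` is the limit of admissible
points that meet `W ⊗ t⁻¹` in a smaller subspace. -/
theorem exists_shear (hB : B.IsAlt) (hnd : Separates B) {U : Submodule ℂ (ℤ →₀ W)}
    (hU : U ∈ sato (loopBasis w) 0) (hadm : IsAdmissible B U) (hne : ¬ U ⊓ lo ≤ ⊥) :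
    ∃ (y : Module.End ℂ (ℤ →₀ W)) (M : ℕ), y ∘ₗ y = 0 ∧
      (∀ j, j ≤ -(M : ℤ) → y (loopBasis w j) = 0) ∧
      ∀ s : ℂ, s ≠ 0 → IsAdmissible B (U.map (LinearMap.id + s • y)) ∧
        Module.finrank ℂ ↥(U.map (LinearMap.id + s • y) ⊓ residue) <
          Module.finrank ℂ ↥(U ⊓ residue) := by
  obtain ⟨K, u, -, -, -, hK⟩ := exists_hi_le w hU 0
  have hUK : ∀ y ∈ U, y ∈ hi (-(K : ℤ)) := fun y hy =>
    le_hi_of_isotropic hnd hK fun z hz => hadm.isotropic z hz y hy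
  obtain ⟨x, hx, hx0⟩ := SetLike.not_le_iff_exists.1 hne
  obtain ⟨p, hpU, hpr, hp0⟩ := exists_mem_residue hadm hx.1 hx.2 hx0
  have hp1 : p (-1) ≠ 0 := fun h => hp0 (Finsupp.ext fun i => by
    rcases eq_or_ne i (-1) with rfl | hi
    · exact h
    · exact hpr i hi)
  -- A maximal `m` exists: since `U ⊆ t^(-K) W[t]`, elements of `τ^K U` have no coefficient at
  -- `t⁻¹`, while `p` has one.
  obtain ⟨m, ⟨u, huU, hup⟩, hmax⟩ : ∃ m : ℕ, (∃ u ∈ U, (tau ^ m) u = p) ∧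
      ¬ ∃ u ∈ U, (tau ^ (m + 1)) u = p := by
    by_contra! hcon
    have hall : ∀ m : ℕ, ∃ u ∈ U, (tau ^ m) u = p := by
      intro m
      induction m with
      | zero => exact ⟨p, hpU, rfl⟩
      | succ m ih =>
        obtain ⟨u, hu, hup⟩ := ih
        obtain ⟨u', hu', h⟩ := hcon m ⟨u, hu, hup⟩
        exact ⟨u', hu', h⟩
    obtain ⟨u, hu, hup⟩ := hall K
    refine hp1 ?_
    rw [← hup, tau_pow_apply, if_neg (by omega)]
    exact hUK u hu _ (by omega)
  have hulo : u ∈ lo := by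
    intro i hi
    have h1 := DFunLike.congr_fun hup (i + m)
    rwa [tau_pow_apply, if_neg (by omega), add_sub_cancel_right, hpr _ (by omega)] at h1
  -- Applying `τ^(m+1)` to `t^K W[t] ⊆ U` shifts it to `t^L W[t]`.
  set L : ℕ := K + (m + 1) with hL
  have hY : hi (L : ℤ) ≤ U.map (tau ^ (m + 1)) := by
    refine hi_le fun i a hi => ⟨Finsupp.single (i - (m + 1 : ℕ)) a,
      hK (single_mem_hi (by omega) a), ?_⟩
    rw [tau_pow_single (by omega), sub_add_cancel]
  have hpY : p ∉ U.map (tau ^ (m + 1)) := fun ⟨u, hu, h⟩ => hmax ⟨u, hu, h⟩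
  obtain ⟨f, hfL, hfp, hfY⟩ := exists_lform_ne_zero w hB hnd L hY hpY
    (hi_anti (by omega) (hUK p hpU))
  have hfU : ∀ x ∈ U, lform B f ((tau ^ (m + 1)) x) = 0 := by
    intro x hx
    refine hfY _ ?_
    have h1 : (tau ^ (m + 1)) x ∈ hi (-(L : ℤ)) :=
      hi_anti (by omega) (hUK _ (tau_pow_mem hadm.tau_mem _ hx))
    have h2 := (U.map (tau ^ (m + 1))).sub_mem ⟨x, hx, rfl⟩ (hY (sub_cut_mem_hi h1))
    rwa [sub_sub_cancel] at h2
  -- `f` is orthogonal to `τ^(m+1) U`, so `τ^(m+1) f` is orthogonal to `U`, which is Lagrangian.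
  have htf : (tau ^ (m + 1)) f ∈ U := by
    refine mem_of_forall_lform_eq_zero w hB hnd hU hadm.isotropic fun x hx => ?_
    rw [lform_neg hB, lform_tau_pow, hfU x hx, neg_zero]
  refine ⟨shear B f m, d * L, shear_comp_shear hB f m, ?_, fun s hs => ⟨⟨?_, ?_⟩, ?_⟩⟩
  · intro j hj
    have h1 : loopBasis w j ∈ hi (L : ℤ) := by
      rw [← lower_loopBasis w]
      exact basis_mem_lower _ (by exact_mod_cast hj)
    rw [shear_apply]
    refine Finset.sum_eq_zero fun i _ => ?_
    rw [lform_hi B (show 0 ≤ -(L : ℤ) + L by omega) (window_le_hi L hfL)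
      (tau_pow_mem (fun y hy => tau_mem_hi hy) i h1), zero_smul]
  · rintro _ ⟨x, hx, rfl⟩ _ ⟨y, hy, rfl⟩
    exact (lform_add_smul_shear hB f m s x y).trans (hadm.isotropic x hx y hy)
  · rintro _ ⟨x, hx, rfl⟩
    -- Of the two boundary terms in `tau_shear`, one vanishes on `U` and the other lies in `U` and
    -- is killed by the shear.
    refine ⟨tau x + (s * lform B f x) • (tau ^ (m + 1)) f,
      U.add_mem (hadm.tau_mem x hx) (U.smul_mem _ htf), ?_⟩
    have h1 := tau_shear (B := B) f m x
    rw [hfU x hx, zero_smul, sub_zero] at h1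
    simp only [LinearMap.add_apply, LinearMap.id_apply, LinearMap.smul_apply, map_add, map_smul,
      h1, shear_tau_pow hB, smul_zero, add_zero, smul_add, smul_smul]
    abel
  · have hfin : Module.Finite ℂ ↥(U ⊓ residue) := by
      have := (finite_window w 1).1
      refine Submodule.finiteDimensional_of_le (inf_le_right.trans
        (show residue ≤ window 1 from fun x hx i hi => hx i (by omega)))
    -- Pair `z` with the sheared `u`, where `τ^m u = p`. Since `z` and `u` lie in `lo` and `tau`
    -- kills `z`, only the term `i = m` survives, leaving `s ⟨f, p⟩ ⟨z, f⟩ = 0`.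
    have key : ∀ z ∈ U.map (LinearMap.id + s • shear B f m) ⊓ residue,
        lform B f z = 0 := by
      rintro z ⟨⟨x, hx, hxz⟩, hz⟩
      have h1 : lform B z (u + s • shear B f m u) = 0 := by
        rw [← hxz]
        exact (lform_add_smul_shear hB f m s x u).trans (hadm.isotropic x hx u huU)
      rw [map_add, map_smul, lform_lo B (residue_le_lo hz) hulo, zero_add, shear_apply,
        map_sum, Finset.sum_range_succ, Finset.sum_eq_zero, zero_add, Nat.sub_self, hup, map_smul,
        pow_zero, Module.End.one_apply, smul_eq_mul, smul_eq_mul,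
        lform_neg hB f z] at h1
      · simpa [hs, hfp] using h1
      · intro i hi
        have := Finset.mem_range.1 hi
        rw [map_smul, ← lform_tau_pow B (m - i) z f, tau_pow_residue hz (by omega), map_zero,
          LinearMap.zero_apply, smul_zero]
    refine Submodule.finrank_lt_finrank_of_lt (lt_of_le_of_ne ?_ ?_)
    · rintro z hz
      have hz' := key z hz
      obtain ⟨⟨x, hx, hxz⟩, hzr⟩ := hz
      refine ⟨?_, hzr⟩
      -- The term `i = 0` vanishes by `key`, the others because `tau` kills `z`. So `z` is fixed by
      -- the shear and already lies in `U`.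
      have h1 : shear B f m z = 0 := by
        rw [shear_apply]
        refine Finset.sum_eq_zero fun i _ => ?_
        rcases Nat.eq_zero_or_pos i with rfl | hi
        · rw [pow_zero, Module.End.one_apply, hz', zero_smul]
        · rw [tau_pow_residue hzr (by omega), map_zero, zero_smul]
      have h2 : shear B f m z = shear B f m x := by
        rw [← hxz, LinearMap.add_apply, LinearMap.id_apply, LinearMap.smul_apply, map_add,
          map_smul, ← LinearMap.comp_apply (shear B f m), shear_comp_shear hB,
          LinearMap.zero_apply, smul_zero, add_zero]
      rw [← hxz, LinearMap.add_apply, LinearMap.id_apply, LinearMap.smul_apply, ← h2, h1,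
        smul_zero, add_zero]
      exact hx
    -- The inclusion is strict: `p` lies in `U ⊓ residue` but violates `key`.
    · intro heq
      exact hfp (key p (heq ▸ ⟨hpU, hpr⟩))

end Shear

/-! ### The group orbit as a set of subspaces `(1 + X) W[t]`. -/

section Orbit

variable {W : Type*} [AddCommGroup W] [Module ℂ W] {B : LinearMap.BilinForm ℂ W}

theorem mem_sp_iff {x : Module.End ℂ W} : x ∈ sp B ↔ ∀ a b, B (x a) b = -B a (x b) := by
  rw [LinearMap.mem_skewAdjointSubmodule]
  simp [LinearMap.IsSkewAdjoint, LinearMap.IsAdjointPair]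

theorem loopAct_single_apply (X : SpLoop B) (j : ℤ) (a : W) (i : ℤ) :
    loopAct B X (Finsupp.single j a) i =
      if 0 ≤ j ∧ i < 0 then (X (j - 1 - i).toNat : Module.End ℂ W) a else 0 := by
  have hdeg : ∀ (x : Module.End ℂ W) (k : ℕ), degAct x (-((k : ℤ) + 1)) (Finsupp.single j a) i =
      if 0 ≤ j ∧ i < 0 ∧ (k : ℤ) = j - 1 - i then x a else 0 := by
    intro x k
    rw [degAct, Finsupp.lsum_single]
    split_ifs with h1 h2 h2
    · rw [LinearMap.comp_apply, Finsupp.lsingle_apply, Finsupp.single_apply, if_pos (by omega)]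
    · rw [LinearMap.comp_apply, Finsupp.lsingle_apply, Finsupp.single_apply, if_neg (by omega)]
    · omega
    · rfl
  rw [loopAct, Finsupp.sum, LinearMap.sum_apply, Finsupp.finsetSum_apply]
  simp only [hdeg]
  split_ifs with h
  · rw [Finset.sum_eq_single (j - 1 - i).toNat]
    · rw [if_pos (by omega)]
    · intro k _ hk
      rw [if_neg (by omega)]
    · intro hX
      rw [Finsupp.notMem_support_iff.1 hX]
      simp
  · exact Finset.sum_eq_zero fun k _ => if_neg (by omega)

theorem loopAct_mem_lo (X : SpLoop B) (x : ℤ →₀ W) : loopAct B X x ∈ lo := by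
  induction x using Finsupp.induction_linear with
  | zero => simp
  | add x y hx hy => rw [map_add]; exact lo.add_mem hx hy
  | single j a =>
    intro i hi
    rw [loopAct_single_apply, if_neg (by omega)]

theorem loopAct_eq_zero_of_mem_lo (X : SpLoop B) {x : ℤ →₀ W} (hx : x ∈ lo) :
    loopAct B X x = 0 := by
  rw [← x.sum_single, Finsupp.sum, map_sum]
  refine Finset.sum_eq_zero fun j hj => ?_
  ext i
  rw [loopAct_single_apply, if_neg]
  · rfl
  · rintro ⟨h, -⟩
    exact Finsupp.mem_support_iff.1 hj (hx j h)

theorem loopAct_comp_loopAct (X : SpLoop B) : loopAct B X ∘ₗ loopAct B X = 0 :=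
  LinearMap.ext fun _ => loopAct_eq_zero_of_mem_lo X (loopAct_mem_lo X _)

theorem lform_loopAct_add (X : SpLoop B) (x y : ℤ →₀ W) :
    lform B (loopAct B X x) y + lform B x (loopAct B X y) = 0 := by
  induction x using Finsupp.induction_linear with
  | zero => simp
  | add x₁ x₂ h₁ h₂ =>
    simp only [map_add, LinearMap.add_apply]
    linear_combination h₁ + h₂
  | single i a =>
    induction y using Finsupp.induction_linear with
    | zero => simp
    | add x₁ x₂ h₁ h₂ =>
      simp only [map_add] at h₁ h₂ ⊢
      linear_combination h₁ + h₂
    | single j b =>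
      have h1 : ∀ z : ℤ →₀ W, lform B z (Finsupp.single j b) = B (z (-1 - j)) b := by
        intro z
        induction z using Finsupp.induction_linear with
        | zero => simp
        | add x₁ x₂ h₁ h₂ => simp only [map_add, LinearMap.add_apply, Finsupp.add_apply, h₁, h₂]
        | single k c =>
          rw [lform_single_left]
          simp only [Finsupp.single_apply]
          by_cases h : j = -1 - k
          · rw [if_pos h, if_pos (by omega)]
          · rw [if_neg h, if_neg (by omega)]; simp
      rw [h1, lform_single_left, loopAct_single_apply, loopAct_single_apply]
      by_cases h : 0 ≤ i ∧ 0 ≤ j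
      · rw [if_pos (by omega), if_pos (by omega), show i - 1 - (-1 - j) = i + j by ring,
          show j - 1 - (-1 - i) = i + j by ring, mem_sp_iff.1 (X (i + j).toNat).2]
        ring
      · rw [if_neg (by omega), if_neg (by omega)]
        simp

/-- On `W[t]` the matrix entry of `X` from `t^j` to `t^i` depends only on `j - i`, and the part
pushed up to `W ⊗ 1` is deleted on both sides. -/
theorem tau_loopAct (X : SpLoop B) {x : ℤ →₀ W} (hx : x ∈ hi 0) :
    tau (loopAct B X x) = loopAct B X (tau x) := by
  rw [← x.sum_single, Finsupp.sum]
  simp only [map_sum]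
  refine Finset.sum_congr rfl fun j hj => ?_
  have hj0 : 0 ≤ j := by
    by_contra h
    exact Finsupp.mem_support_iff.1 hj (hx j (by omega))
  ext i
  rw [tau_single, if_neg (by omega), tau_apply, loopAct_single_apply, loopAct_single_apply]
  split_ifs <;> first | rfl | omega | (congr 3; omega)

/-- The image of `W[t]` under `1 + X` is admissible. -/
theorem isAdmissible_map_loopAct (X : SpLoop B) :
    IsAdmissible B ((hi 0).map (LinearMap.id + loopAct B X)) where
  isotropic := by
    rintro _ ⟨x, hx, rfl⟩ _ ⟨y, hy, rfl⟩
    have h1 := lform_loopAct_add X x y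
    have h2 := lform_lo B (loopAct_mem_lo X x) (loopAct_mem_lo X y)
    have h3 := lform_hi B (le_refl (0 + 0 : ℤ)) hx hy
    simp only [LinearMap.add_apply, LinearMap.id_apply, map_add, h2, h3]
    linear_combination h1
  tau_mem := by
    rintro _ ⟨x, hx, rfl⟩
    refine ⟨tau x, tau_mem_hi hx, ?_⟩
    simp only [LinearMap.add_apply, LinearMap.id_apply, map_add, tau_loopAct X hx]

variable {d : ℕ} [NeZero d] (w : Module.Basis (Fin d) ℂ W)

theorem hi_zero_eq_frameSpan (N : ℕ) :
    hi (W := W) 0 = frameSpan (loopBasis w) N fun a => loopBasis w (-(a : ℤ)) := by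
  have h0 : hi (W := W) 0 = frameSpan (loopBasis w) 0 Fin.elim0 := by
    have := lower_loopBasis w 0
    rw [mul_zero] at this
    rw [frameSpan, Set.range_eq_empty, Submodule.span_empty, bot_sup_eq, ← this]
    rfl
  rw [h0, ← frameSpan_extend (loopBasis w) (Nat.zero_le N)]
  rfl

theorem vac_eq_wedge (N : ℕ) : vac = wedge (loopBasis w) N fun a => loopBasis w (-(a : ℤ)) :=
  (wedge_maya (loopBasis w) (S := vacIdx) fun _ _ => rfl).symm

theorem exists_loopAct_eq_zero (X : SpLoop B) :
    ∃ F : Finset ℤ, ∀ j ∉ F, loopAct B X (loopBasis w j) = 0 := by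
  classical
  obtain ⟨M, hM⟩ := X.support.bddAbove
  refine ⟨((Finset.Icc (0 : ℤ) M).sigma fun _ => Finset.univ).map
    (foldEquiv d).toEmbedding, fun j hj => ?_⟩
  obtain ⟨⟨i, a⟩, rfl⟩ := (foldEquiv d).surjective j
  have h1 : loopBasis w (foldEquiv d ⟨i, a⟩) = Finsupp.single i (w a) := by simp [loopBasis]
  rw [h1]
  have hi : ¬ (0 ≤ i ∧ i ≤ M) := fun h => hj (by simpa using h)
  ext k
  rw [loopAct_single_apply]
  split_ifs with h
  · have : X (i - 1 - k).toNat = 0 := by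
      by_contra hX
      have := hM (Finsupp.mem_support_iff.2 hX)
      omega
    rw [this]
    rfl
  · rfl

/-- `W[t]` is the point of the vacuum, and the exponential acts as the operator induced by `1 + X`.
-/
theorem exp_fockAct_vac (X : SpLoop B) :
    (hi 0).map (LinearMap.id + loopAct B X) ∈ sato (loopBasis w) 0 ∧
      Submodule.span ℂ {IsNilpotent.exp (fockAct B w X) vac} =
        pluckerLine (loopBasis w) ((hi 0).map (LinearMap.id + loopAct B X)) := by
  obtain ⟨F, hF⟩ := exists_loopAct_eq_zero w X
  obtain ⟨m, hm⟩ := F.bddBelow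
  have hM : ∀ j, j ≤ -(((1 - m).toNat : ℕ) : ℤ) → loopAct B X (loopBasis w j) = 0 := by
    intro j hj
    refine hF j fun hjF => ?_
    have := hm hjF
    omega
  have hfix : ∀ j, j ≤ -(((1 - m).toNat : ℕ) : ℤ) →
      (LinearMap.id + loopAct B X : (ℤ →₀ W) →ₗ[ℂ] _) (loopBasis w j) = loopBasis w j := by
    intro j hj
    simp [hM j hj]
  constructor
  · have h0 : hi (W := W) 0 ∈ sato (loopBasis w) 0 := by
      refine (sato_zero_iff _).2 ⟨0, _, hi_zero_eq_frameSpan w 0, ?_⟩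
      rw [← vac_eq_wedge]
      exact Finsupp.single_ne_zero.2 one_ne_zero
    have := map_shear_mem_sato (loopBasis w) h0 (loopAct_comp_loopAct X) hM 1
    rwa [one_smul] at this
  · rw [fockAct, (derivAct_isNilpotent_and_exp _ (loopAct_comp_loopAct X) hF).2,
      vac_eq_wedge w (1 - m).toNat, gact_wedge _ hfix, hi_zero_eq_frameSpan w (1 - m).toNat,
      map_frameSpan _ hfix, pluckerLine_frameSpan]

theorem exp_fockAct_vac_mem (X : SpLoop B) :
    IsNilpotent.exp (fockAct B w X) vac ∈ vacModule B w := by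
  obtain ⟨F, hF⟩ := exists_loopAct_eq_zero w X
  obtain ⟨k, hk⟩ := (derivAct_isNilpotent_and_exp _ (loopAct_comp_loopAct X) hF).1
  refine ⟨IsNilpotent.exp (fockAct B w X), ?_, rfl⟩
  rw [IsNilpotent.exp_eq_sum (show fockAct B w X ^ k = 0 from hk)]
  refine Submodule.sum_mem _ fun i _ => ?_
  rw [← Rat.cast_smul_eq_qsmul ℂ]
  exact Submodule.smul_mem _ _
    (Subalgebra.pow_mem _ (Algebra.subset_adjoin (Set.mem_range_self X)) i)

/-- The orbit consists of the points of the Grassmannian given by the images of `W[t]`. -/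
theorem mem_orbit_iff {p : ℙ ℂ (vacModule B w)} : p ∈ orbit B w ↔
    ∃ X : SpLoop B, p.submodule.map (vacModule B w).subtype =
      pluckerLine (loopBasis w) ((hi 0).map (LinearMap.id + loopAct B X)) := by
  simp only [← (exp_fockAct_vac w _).2]
  rfl

theorem exists_mem_orbit (X : SpLoop B) : ∃ p ∈ orbit B w,
    p.submodule.map (vacModule B w).subtype =
      pluckerLine (loopBasis w) ((hi 0).map (LinearMap.id + loopAct B X)) := by
  have hne : IsNilpotent.exp (fockAct B w X) vac ≠ 0 := by
    intro h0
    obtain ⟨hs, he⟩ := exp_fockAct_vac w X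
    obtain ⟨N, u, hu, hw⟩ := (sato_zero_iff _).1 hs
    rw [h0, hu, pluckerLine_frameSpan, Submodule.span_zero_singleton, eq_comm,
      Submodule.span_singleton_eq_bot] at he
    exact hw he
  set x : vacModule B w := ⟨_, exp_fockAct_vac_mem w X⟩ with hx
  have hx0 : x ≠ 0 := fun h => hne (congrArg Subtype.val h)
  have h1 : (Projectivization.mk ℂ x hx0).submodule.map (vacModule B w).subtype =
      pluckerLine (loopBasis w) ((hi 0).map (LinearMap.id + loopAct B X)) := by
    rw [Projectivization.submodule_mk, Submodule.map_span, Set.image_singleton,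
      ← (exp_fockAct_vac w X).2]
    rfl
  exact ⟨_, (mem_orbit_iff w).2 ⟨X, h1⟩, h1⟩

end Orbit

/-! ### The closure of the orbit is the set of admissible points. -/

section Closure

variable {W : Type*} [AddCommGroup W] [Module ℂ W] {B : LinearMap.BilinForm ℂ W}
  {d : ℕ} [NeZero d] (w : Module.Basis (Fin d) ℂ W)

theorem tau_pow_mem_lo {x : ℤ →₀ W} (hx : x ∈ lo) (m : ℕ) : (tau ^ m) x ∈ lo :=
  tau_pow_mem (fun _ h => tau_mem_lo h) m hx

/-- An admissible point transversal to `t⁻¹ W[t⁻¹]` projects onto `W[t]`. -/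
theorem exists_sub_mem_lo (hB : B.IsAlt) (hnd : Separates B) {U : Submodule ℂ (ℤ →₀ W)}
    (hU : U ∈ sato (loopBasis w) 0) (hiso : ∀ x ∈ U, ∀ y ∈ U, lform B x y = 0)
    (hlo : U ⊓ lo ≤ ⊥) {h : ℤ →₀ W} (hh : h ∈ hi 0) : ∃ g ∈ lo, h + g ∈ U := by
  obtain ⟨K, u, -, -, -, hK⟩ := exists_hi_le w hU 0
  have hUK : ∀ y ∈ U, y ∈ hi (-(K : ℤ)) := fun y hy =>
    le_hi_of_isotropic hnd hK fun z hz => hiso z hz y hy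
  have key : h ∈ U ⊔ lo := by
    -- Otherwise some `f` is orthogonal to `U` and to `lo`. As both are their own orthogonal
    -- complements, `f ∈ U ⊓ lo`, so `f = 0`, although `f` detects `h`.
    by_contra hcon
    obtain ⟨f, hfK, hfh, hf⟩ := exists_lform_ne_zero w hB hnd K (hK.trans le_sup_left) hcon
      (hi_anti (by omega) hh)
    have hfU : f ∈ U := by
      refine mem_of_forall_lform_eq_zero w hB hnd hU hiso fun y hy => ?_
      rw [lform_neg hB, neg_eq_zero]
      refine hf y (Submodule.mem_sup_left ?_)
      have := U.sub_mem hy (hK (sub_cut_mem_hi (hUK y hy)))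
      rwa [sub_sub_cancel] at this
    have hflo : f ∈ lo := by
      intro i hi
      refine hnd.eq_zero fun a => ?_
      rw [lform_neg hB, neg_eq_zero]
      refine hf _ (Submodule.mem_sup_right fun j hj => ?_)
      rw [cut_apply, Finsupp.single_eq_of_ne (by omega), ite_self]
    have : f = 0 := hlo ⟨hfU, hflo⟩
    rw [this] at hfh
    simp at hfh
  obtain ⟨x, hx, g, hg, rfl⟩ := Submodule.mem_sup.1 key
  exact ⟨-g, lo.neg_mem hg, by simpa using hx⟩

/-- An admissible point transversal to `t⁻¹ W[t⁻¹]` is the graph of an element of the abelian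
Lie algebra. -/
theorem exists_eq_map_loopAct (hB : B.IsAlt) (hnd : Separates B) {U : Submodule ℂ (ℤ →₀ W)}
    (hU : U ∈ sato (loopBasis w) 0) (hadm : IsAdmissible B U) (hlo : U ⊓ lo ≤ ⊥) :
    ∃ X : SpLoop B, U = (hi 0).map (LinearMap.id + loopAct B X) := by
  choose g hg hgU using fun j => exists_sub_mem_lo w hB hnd hU hadm.isotropic hlo
    (single_mem_hi le_rfl (w j))
  -- `U` is the graph of a map `W[t] → lo`; `G` is its restriction to `W ⊗ 1`, and `τ`-stability
  -- gives the rest as `τ^k G`.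
  set G : W →ₗ[ℂ] (ℤ →₀ W) := w.constr ℂ g with hG
  have hGw : ∀ j, G (w j) = g j := fun j => w.constr_basis ℂ g j
  have hGlo : ∀ a, G a ∈ lo := by
    have : (⊤ : Submodule ℂ W) ≤ lo.comap G := by
      rw [← w.span_eq, Submodule.span_le]
      rintro _ ⟨j, rfl⟩
      rw [SetLike.mem_coe, Submodule.mem_comap, hGw]
      exact hg j
    exact fun a => this trivial
  have hGU : ∀ a, Finsupp.single 0 a + G a ∈ U := by
    have : (⊤ : Submodule ℂ W) ≤ U.comap (Finsupp.lsingle 0 + G) := by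
      rw [← w.span_eq, Submodule.span_le]
      rintro _ ⟨j, rfl⟩
      rw [SetLike.mem_coe, Submodule.mem_comap, LinearMap.add_apply, hGw]
      exact hgU j
    exact fun a => this trivial
  have hpowU : ∀ (k : ℕ) a, Finsupp.single (k : ℤ) a + (tau ^ k) (G a) ∈ U := by
    intro k a
    have := tau_pow_mem hadm.tau_mem k (hGU a)
    rwa [map_add, tau_pow_single le_rfl, zero_add] at this
  let x : ℕ → Module.End ℂ W := fun k => Finsupp.lapply (-1 - (k : ℤ)) ∘ₗ G
  -- Isotropy for `a t^k + τ^k G a` and `b + G b`: only the mixed pairings survive, and they involve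
  -- the coefficients at `t^(-1-k)`.
  have hxsp : ∀ k, x k ∈ sp B := by
    intro k
    rw [mem_sp_iff]
    intro a b
    have h1 := hadm.isotropic _ (hpowU k a) _ (hGU b)
    rw [map_add, map_add, LinearMap.add_apply, LinearMap.add_apply,
      lform_lo B (tau_pow_mem_lo (hGlo a) k) (hGlo b),
      lform_hi B (by omega) (single_mem_hi le_rfl a) (single_mem_hi le_rfl b),
      lform_tau_pow, tau_pow_single le_rfl, zero_add, lform_single_left,
      lform_neg hB (Finsupp.single _ b), lform_single_left, hB.neg_eq] at h1
    simp only [zero_add, add_zero] at h1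
    simp only [x, LinearMap.comp_apply, Finsupp.lapply_apply]
    linear_combination h1
  obtain ⟨K, hK⟩ := exists_mem_lower_fin (loopBasis w) g
  have hx0 : (Function.support fun k => (⟨x k, hxsp k⟩ : sp B)).Finite := by
    refine (Set.finite_Iio K).subset fun k hk => ?_
    by_contra hkK
    simp only [Set.mem_Iio, not_lt] at hkK
    refine hk (Subtype.ext (w.ext fun j => ?_))
    have h1 : g j ∈ hi (-(K : ℤ)) := by
      rw [← lower_loopBasis w]
      refine lower_mono _ ?_ (hK j)
      rw [mul_neg, neg_neg]
      exact_mod_cast le_mul_of_neZero K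
    simp only [x, LinearMap.comp_apply, hGw, Finsupp.lapply_apply]
    exact h1 _ (by omega)
  let X : SpLoop B := Finsupp.ofSupportFinite _ hx0
  have hact : ∀ (k : ℕ) a, loopAct B X (Finsupp.single (k : ℤ) a) = (tau ^ k) (G a) := by
    intro k a
    ext i
    rw [loopAct_single_apply]
    split_ifs with h
    · rw [tau_pow_apply, if_neg (by omega)]
      change G a (-1 - (((k : ℤ) - 1 - i).toNat : ℤ)) = _
      congr 1
      omega
    · exact (tau_pow_mem_lo (hGlo a) k i (by omega)).symm
  have hle : (hi 0).map (LinearMap.id + loopAct B X) ≤ U := by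
    rw [Submodule.map_le_iff_le_comap]
    refine hi_le fun i a hi => ?_
    obtain ⟨k, rfl⟩ := Int.eq_ofNat_of_zero_le hi
    rw [Submodule.mem_comap, LinearMap.add_apply, LinearMap.id_apply, hact]
    exact hpowU k a
  refine ⟨X, le_antisymm (fun y hy => ?_) hle⟩
  -- The element of the graph over the `W[t]`-part of `y` differs from `y` by an element of `U ⊓
  -- lo`.
  set h : ℤ →₀ W := y.filter fun i => 0 ≤ i with hh
  have hhi : h ∈ hi 0 := fun i hi => Finsupp.filter_apply_neg _ _ (by omega)
  have hmem : h + loopAct B X h ∈ U := hle ⟨h, hhi, rfl⟩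
  have hsub : y - (h + loopAct B X h) ∈ lo := by
    rw [← sub_sub]
    refine lo.sub_mem (fun i hi => ?_) (loopAct_mem_lo X h)
    rw [Finsupp.sub_apply, hh, Finsupp.filter_apply_pos _ _ hi, sub_self]
  have h0 : y - (h + loopAct B X h) = 0 := hlo ⟨U.sub_mem hy hmem, hsub⟩
  exact ⟨h, hhi, (sub_eq_zero.1 h0).symm⟩

/-- Every admissible point of the Grassmannian is in the closure of the orbit. -/
theorem exists_mem_closure (hB : B.IsAlt) (hnd : Separates B) {U : Submodule ℂ (ℤ →₀ W)}
    (hU : U ∈ sato (loopBasis w) 0) (hadm : IsAdmissible B U) :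
    ∃ p ∈ @closure _ (indZariski (vacModule B w)) (orbit B w),
      p.submodule.map (vacModule B w).subtype = pluckerLine (loopBasis w) U := by
  induction hn : Module.finrank ℂ ↥(U ⊓ residue) using Nat.strong_induction_on generalizing U with
  | _ n ih =>
    by_cases hlo : U ⊓ lo ≤ ⊥
    · obtain ⟨X, rfl⟩ := exists_eq_map_loopAct w hB hnd hU hadm hlo
      obtain ⟨p, hp, h⟩ := exists_mem_orbit w X
      exact ⟨p, subset_closure_indZariski _ hp, h⟩
    · obtain ⟨y, M, hy, hM, hs⟩ := exists_shear w hB hnd hU hadm hlo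
      refine exists_mem_of_shear (loopBasis w) (isIndClosed_closure _) hU hy hM fun s hs0 => ?_
      obtain ⟨h1, h2⟩ := hs s hs0
      exact ih _ (hn ▸ h2) (map_shear_mem_sato _ hU hy hM s) h1 rfl

/-- Every point in the closure of the orbit is an admissible point of the Grassmannian. -/
theorem exists_admissible_of_mem_closure (hB : B.IsAlt) (hnd : Separates B)
    {p : ℙ ℂ (vacModule B w)}
    (hp : p ∈ @closure _ (indZariski (vacModule B w)) (orbit B w)) :
    ∃ U ∈ sato (loopBasis w) 0, IsAdmissible B U ∧
      p.submodule.map (vacModule B w).subtype = pluckerLine (loopBasis w) U := by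
  have hcl := mem_closure_iff_of_isIndClosed.1 hp _
    (isIndClosed_isotropic (loopBasis w) {lform B, lform B ∘ₗ tau})
  have hsub : ∀ q ∈ orbit B w, ∃ U ∈ sato (loopBasis w) 0,
      (∀ b ∈ ({lform B, lform B ∘ₗ tau} : Set _), ∀ x ∈ U, ∀ y ∈ U, b x y = 0) ∧
      q.submodule.map (vacModule B w).subtype = pluckerLine (loopBasis w) U := by
    intro q hq
    obtain ⟨X, hX⟩ := (mem_orbit_iff w).1 hq
    have hadm := isAdmissible_map_loopAct X
    refine ⟨_, (exp_fockAct_vac w X).1, ?_, hX⟩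
    rintro b (rfl | rfl) x hx y hy
    · exact hadm.isotropic x hx y hy
    · exact hadm.isotropic _ (hadm.tau_mem x hx) y hy
  obtain ⟨U, hU, hbs, h⟩ := hcl hsub
  have hiso := hbs _ (Or.inl rfl)
  refine ⟨U, hU, ⟨hiso, fun x hx => ?_⟩, h⟩
  -- Stability follows from the second form: `τ x` is orthogonal to the Lagrangian `U`.
  refine mem_of_forall_lform_eq_zero w hB hnd hU hiso fun y hy => ?_
  rw [← lform_tau]
  exact hbs _ (Or.inr rfl) y hy x hx

theorem submodule_map_eq (p : ℙ ℂ (vacModule B w)) :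
    (Projectivization.map (vacModule B w).subtype (vacModule B w).injective_subtype p).submodule =
      p.submodule.map (vacModule B w).subtype := by
  induction p using Projectivization.ind with
  | h x hx =>
    rw [Projectivization.map_mk, Projectivization.submodule_mk, Projectivization.submodule_mk,
      Submodule.map_span, Set.image_singleton]

theorem isAdmissible_iff {U : Submodule ℂ (ℤ →₀ W)} : IsAdmissible B U ↔
    (∀ x ∈ U, ∀ y ∈ U, loopForm B x y = 0) ∧ U.map (pr ∘ₗ mulT) ≤ U := by
  simp only [loopForm_eq]
  exact ⟨fun h => ⟨h.1, Submodule.map_le_iff_le_comap.2 h.2⟩,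
    fun h => ⟨h.1, Submodule.map_le_iff_le_comap.1 h.2⟩⟩

end Closure

end SemiInf

end
theorem theorem4 (n : ℕ) [NeZero n] {W : Type*} [AddCommGroup W] [Module ℂ W]
    (B : LinearMap.BilinForm ℂ W) (hB : B.IsAlt) (hnd : B.Nondegenerate)
    (w : Module.Basis (Fin (2 * n)) ℂ W)
    (hw : ∀ i : Fin (2 * n), (i : ℕ) < n → B (w i) (w i.rev) = 1) :
    (∀ p ∈ SemiInf.orbitClosure B w, ∃ U ∈ SemiInf.sato (SemiInf.loopBasis w) 0,
      p.submodule = SemiInf.pluckerLine (SemiInf.loopBasis w) U) ∧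
    ∀ U ∈ SemiInf.sato (SemiInf.loopBasis w) 0,
      ((∃ p ∈ SemiInf.orbitClosure B w, p.submodule = SemiInf.pluckerLine (SemiInf.loopBasis w) U) ↔
        (∀ x ∈ U, ∀ y ∈ U, SemiInf.loopForm B x y = 0) ∧ U.map (SemiInf.pr ∘ₗ SemiInf.mulT) ≤ U) := by
  have hsep : SemiInf.Separates B := hnd.2
  refine ⟨?_, fun U hU => ⟨?_, fun h => ?_⟩⟩
  · rintro _ ⟨p, hp, rfl⟩
    obtain ⟨U, hU, -, h⟩ := SemiInf.exists_admissible_of_mem_closure w hB hsep hp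
    exact ⟨U, hU, by rw [SemiInf.submodule_map_eq, h]⟩
  · rintro ⟨_, ⟨p, hp, rfl⟩, h⟩
    obtain ⟨U', hU', hadm, h'⟩ := SemiInf.exists_admissible_of_mem_closure w hB hsep hp
    rw [SemiInf.submodule_map_eq, h'] at h
    -- The admissible subspace supplied by the closure has the same Plücker line as `U`, hence
    -- equals `U`.
    rw [← SemiInf.pluckerLine_injOn _ hU' hU h]
    exact SemiInf.isAdmissible_iff.1 hadm
  · obtain ⟨p, hp, h'⟩ := SemiInf.exists_mem_closure w hB hsep hU (SemiInf.isAdmissible_iff.2 h)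
    exact ⟨_, ⟨p, hp, rfl⟩, by rw [SemiInf.submodule_map_eq, h']⟩
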